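/- Let $M$ be a finite-dimensional smooth real manifold, $\mathfrak M$ a complex Hilbert space with scalar product $\langle\cdot|\cdot\rangle$ (conjugate linear in the first argument), and $\mathcal K:M\to\mathbb{CP}(\mathfrak M)$ a smooth map, described by smooth local lifts $K_\alpha:\Omega_\alpha\to\mathfrak M\setminus\{0\}$ with $[K_\alpha(m)]=\mathcal K(m)$ for $m\in\Omega_\alpha$, where the open sets $\Omega_\alpha$ cover $M$. Let $\mathbb L\to M$ be the pull-back by $\mathcal K$ of the universal line bundle, so that $\mathbb L_m\subset\mathfrak M$ is the line $\mathcal K(m)$, with basic sections $s_\alpha(m)=(m,K_\alpha(m))$, and let $\nabla$ be its canonical connection (derivative in $\mathfrak M$ followed by orthogonal projection to $\mathbb L_m$), so that $$\nabla s_\alpha=\Theta_\alpha\otimes s_\alpha,\qquad \Theta_\alpha=\frac{\langle K_\alpha|dK_\alpha\rangle}{\langle K_\alpha|K_\alpha\rangle},\qquad \omega:=i\,\mathrm{curv}\,\nabla=i\,d\Theta_\alpha \ \text{ on } \Omega_\alpha .$$ Let $\overline{\mathbb L}^*$ be the dual of the complex conjugate of $\mathbb L$, with the induced connection $\overline\nabla^*$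 and the basic sections $\overline s^*_\alpha$ dual to $\overline{s_\alpha}$, so that $\overline\nabla^*\overline s_\alpha^*=-\frac{\langle dK_\alpha|K_\alpha\rangle}{\langle K_\alpha|K_\alpha\rangle}\otimes\overline s_\alpha^*$, and for $v\in\mathfrak M$ let $I(v)$ be the section of $\overline{\mathbb L}^*$ with $I(v)(m)=\langle K_\alpha(m)|v\rangle\,\overline s_\alpha^*(m)$ for $m\in\Omega_\alpha$. For $m\in M$ put $$P_m:=\{X(m): X\in\Gamma^\infty(T^{\mathbb C}M),\ \overline\nabla^*_X\psi=0\ \text{ for all }\psi\in I(\mathfrak M)\},\qquad P:=\bigsqcup_{m\in M}P_m ,$$ and let $\Gamma^\infty(P)$ be the set of smooth complex vector fields $X$ with $X(m)\in P_m$ for all $m\in M$ (similarly for $P\cap\overline P$). All forms and derivatives are extended complex linearly to $T^{\mathbb C}M$. Then: 1. A smooth complex vector field $X$ belongs to $\Gamma^\infty(P)$ if and only if $\overline X(K_\alpha)=\Theta_\alpha(\overline X)K_\alpha$ on $\Omega_\alpha$ for every $\alpha$. 2. $P$ is involutive and isotropic: for $X,Y\in\Gamma^\infty(P)$ one has $[X,Y]\in\Gamma^\infty(P)$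 and $\omega(X,Y)=0$. 3. If $X\in\Gamma^\infty(P\cap\overline P)$, then $X\lrcorner\,\omega=0$, that is, $\omega_m(X(m),\eta)=0$ for all $m\in M$ and all $\eta\in T^{\mathbb C}_mM$. 4. For every $X\in\Gamma^\infty(P)$ one has $i\,\omega(X,\overline X)\ge 0$ on $M$ (in particular this function is real). -/

import Mathlib

open scoped Manifold ContDiff Topology TensorProduct ComplexConjugate ComplexOrder LinearAlgebra.Projectivization

noncomputable section

namespace CoherentMap

section Complexification

variable {E : Type*} [NormedAddCommGroup E] [NormedSpace ℝ E]
  {M : Type*} [TopologicalSpace M] [ChartedSpace E M]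

/-- The complexified tangent space `ℂ ⊗ T_m M`. -/
abbrev CTangent (E : Type*) [NormedAddCommGroup E] [NormedSpace ℝ E]
    {M : Type*} [TopologicalSpace M] [ChartedSpace E M] (m : M) : Type _ :=
  ℂ ⊗[ℝ] TangentSpace 𝓘(ℝ, E) m

/-- The real part of a complex tangent vector: `z ⊗ v ↦ Re z • v`. -/
def rePart (m : M) : CTangent E m →ₗ[ℝ] TangentSpace 𝓘(ℝ, E) m :=
  (TensorProduct.lid ℝ (TangentSpace 𝓘(ℝ, E) m)).toLinearMap ∘ₗ
    LinearMap.rTensor (TangentSpace 𝓘(ℝ, E) m) Complex.reLm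

/-- The imaginary part of a complex tangent vector: `z ⊗ v ↦ Im z • v`. -/
def imPart (m : M) : CTangent E m →ₗ[ℝ] TangentSpace 𝓘(ℝ, E) m :=
  (TensorProduct.lid ℝ (TangentSpace 𝓘(ℝ, E) m)).toLinearMap ∘ₗ
    LinearMap.rTensor (TangentSpace 𝓘(ℝ, E) m) Complex.imLm

/-- The complex tangent vector `a + i b` for real tangent vectors `a`, `b`. -/
def mkC {m : M} (a b : TangentSpace 𝓘(ℝ, E) m) : CTangent E m :=
  (1 : ℂ) ⊗ₜ[ℝ] a + Complex.I ⊗ₜ[ℝ] b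

@[simp] theorem rePart_tmul (m : M) (z : ℂ) (v : TangentSpace 𝓘(ℝ, E) m) :
    rePart m (z ⊗ₜ[ℝ] v) = z.re • v := by
  simp [rePart]

@[simp] theorem imPart_tmul (m : M) (z : ℂ) (v : TangentSpace 𝓘(ℝ, E) m) :
    imPart m (z ⊗ₜ[ℝ] v) = z.im • v := by
  simp [imPart]

theorem mkC_rePart_imPart {m : M} (ξ : CTangent E m) : mkC (rePart m ξ) (imPart m ξ) = ξ := by
  induction ξ using TensorProduct.induction_on with
  | zero => simp [mkC]
  | tmul z v =>
    simp only [mkC, rePart_tmul, imPart_tmul, ← TensorProduct.smul_tmul, ← TensorProduct.add_tmul]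
    congr 1
    apply Complex.ext <;> simp
  | add x y hx hy =>
    conv_rhs => rw [← hx, ← hy]
    simp only [mkC, map_add, TensorProduct.tmul_add]
    abel

theorem rePart_smul {m : M} (c : ℂ) (ξ : CTangent E m) :
    rePart m (c • ξ) = c.re • rePart m ξ + (-c.im) • imPart m ξ := by
  induction ξ using TensorProduct.induction_on with
  | zero => simp
  | tmul z v =>
    simp only [TensorProduct.smul_tmul', rePart_tmul, imPart_tmul, smul_smul, ← add_smul,
      smul_eq_mul, Complex.mul_re]
    congr 1; ring
  | add x y hx hy => simp only [smul_add, map_add, hx, hy]; abel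

theorem imPart_smul {m : M} (c : ℂ) (ξ : CTangent E m) :
    imPart m (c • ξ) = c.re • imPart m ξ + c.im • rePart m ξ := by
  induction ξ using TensorProduct.induction_on with
  | zero => simp
  | tmul z v =>
    simp only [TensorProduct.smul_tmul', rePart_tmul, imPart_tmul, smul_smul, ← add_smul,
      smul_eq_mul, Complex.mul_im]
  | add x y hx hy => simp only [smul_add, map_add, hx, hy]; abel

/-- Complex conjugation `z ⊗ v ↦ z̄ ⊗ v` of complex tangent vectors. -/
def conjT (m : M) : CTangent E m →ₗ⋆[ℂ] CTangent E m where
  toFun ξ := LinearMap.rTensor (TangentSpace 𝓘(ℝ, E) m) Complex.conjAe.toLinearMap ξ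
  map_add' := map_add _
  map_smul' c ξ := by
    induction ξ using TensorProduct.induction_on with
    | zero => simp
    | tmul z v => simp [TensorProduct.smul_tmul']
    | add x y hx hy => simp only [smul_add, map_add, hx, hy]

@[simp] theorem conjT_tmul (m : M) (z : ℂ) (v : TangentSpace 𝓘(ℝ, E) m) :
    conjT m (z ⊗ₜ[ℝ] v) = (conj z) ⊗ₜ[ℝ] v := rfl

/-- The derivative at `m` of a function `f` with values in a complex normed space. -/
def rderiv {F : Type*} [NormedAddCommGroup F] [NormedSpace ℂ F] (f : M → F) (m : M) :
    TangentSpace 𝓘(ℝ, E) m →L[ℝ] F :=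
  mfderiv 𝓘(ℝ, E) 𝓘(ℝ, F) f m

/-- The derivative `ξ ↦ ξ(f)` at `m` of a function `f` with values in a complex normed space,
extended complex linearly to complex tangent vectors. -/
def cderiv {F : Type*} [NormedAddCommGroup F] [NormedSpace ℂ F] (f : M → F) (m : M) :
    CTangent E m →ₗ[ℂ] F :=
  LinearMap.liftBaseChange ℂ (rderiv (E := E) f m : TangentSpace 𝓘(ℝ, E) m →ₗ[ℝ] F)

@[simp] theorem cderiv_tmul {F : Type*} [NormedAddCommGroup F] [NormedSpace ℂ F] (f : M → F)
    (m : M) (z : ℂ) (v : TangentSpace 𝓘(ℝ, E) m) :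
    cderiv f m (z ⊗ₜ[ℝ] v) = z • rderiv (E := E) f m v := by
  simp [cderiv]

theorem cderiv_congr {F : Type*} [NormedAddCommGroup F] [NormedSpace ℂ F] {f f' : M → F} {m : M}
    (h : f =ᶠ[𝓝 m] f') : cderiv (E := E) f m = cderiv f' m := by
  have : rderiv (E := E) f m = rderiv f' m := by
    ext v
    simp only [rderiv, h.mfderiv_eq]
  rw [cderiv, cderiv, this]

/-- A complex vector field (a section of the complexified tangent bundle) is smooth if its real
and imaginary parts are smooth vector fields. -/
def IsSmoothField [IsManifold 𝓘(ℝ, E) ∞ M] (X : Π m : M, CTangent E m) : Prop :=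
  ContMDiff 𝓘(ℝ, E) 𝓘(ℝ, E).tangent ∞
      (fun m => (⟨m, rePart m (X m)⟩ : TangentBundle 𝓘(ℝ, E) M)) ∧
    ContMDiff 𝓘(ℝ, E) 𝓘(ℝ, E).tangent ∞
      (fun m => (⟨m, imPart m (X m)⟩ : TangentBundle 𝓘(ℝ, E) M))

section

variable [IsManifold 𝓘(ℝ, E) ∞ M]

theorem isSmoothField_zero : IsSmoothField (0 : Π m : M, CTangent E m) := by
  have : ContMDiff 𝓘(ℝ, E) 𝓘(ℝ, E).tangent ∞ (fun m => (⟨m, 0⟩ : TangentBundle 𝓘(ℝ, E) M)) :=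
    Bundle.contMDiff_zeroSection ℝ (TangentSpace 𝓘(ℝ, E))
  constructor <;> simpa using this

theorem IsSmoothField.add {X Y : Π m : M, CTangent E m} (hX : IsSmoothField X)
    (hY : IsSmoothField Y) : IsSmoothField (X + Y) := by
  refine ⟨?_, ?_⟩
  · simpa only [Pi.add_apply, map_add] using! hX.1.add_section hY.1
  · simpa only [Pi.add_apply, map_add] using! hX.2.add_section hY.2

theorem IsSmoothField.smul {X : Π m : M, CTangent E m} (hX : IsSmoothField X) (c : ℂ) :
    IsSmoothField (c • X) := by
  refine ⟨?_, ?_⟩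
  · simpa only [Pi.smul_apply, rePart_smul] using!
      (hX.1.const_smul_section (a := c.re)).add_section (hX.2.const_smul_section (a := -c.im))
  · simpa only [Pi.smul_apply, imPart_smul] using!
      (hX.2.const_smul_section (a := c.re)).add_section (hX.1.const_smul_section (a := c.im))

end

/-- The Lie bracket of complex vector fields: the complex bilinear extension of the Lie bracket
of real vector fields. -/
def cbracket (X Y : Π m : M, CTangent E m) (m : M) : CTangent E m :=
  mkC
    (VectorField.mlieBracket 𝓘(ℝ, E) (fun p => rePart p (X p)) (fun p => rePart p (Y p)) m -
      VectorField.mlieBracket 𝓘(ℝ, E) (fun p => imPart p (X p)) (fun p => imPart p (Y p)) m)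
    (VectorField.mlieBracket 𝓘(ℝ, E) (fun p => rePart p (X p)) (fun p => imPart p (Y p)) m +
      VectorField.mlieBracket 𝓘(ℝ, E) (fun p => imPart p (X p)) (fun p => rePart p (Y p)) m)

/-- The smooth sections of a complex distribution `D ⊂ T^ℂ M`. -/
def smoothSections [IsManifold 𝓘(ℝ, E) ∞ M] (D : Π m : M, Submodule ℂ (CTangent E m)) : Set (Π m : M, CTangent E m) :=
  {X | IsSmoothField X ∧ ∀ m, X m ∈ D m}

/-- The coordinate expression, in the preferred chart at `m`, of a complex valued one-form `θ`
on `M`. -/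
def chartForm (θ : Π p : M, TangentSpace 𝓘(ℝ, E) p →L[ℝ] ℂ) (m : M) (y : E) : E →L[ℝ] ℂ :=
  (θ ((extChartAt 𝓘(ℝ, E) m).symm y)).comp
    (mfderiv 𝓘(ℝ, E) 𝓘(ℝ, E) (extChartAt 𝓘(ℝ, E) m).symm y)

/-- The value at `m` of the exterior derivative of a complex valued one-form `θ`, computed in the
preferred chart at `m`: `dθ(a, b) = ∂_a (θ(b)) - ∂_b (θ(a))` for constant `a`, `b` in the chart. -/
def extDer (θ : Π p : M, TangentSpace 𝓘(ℝ, E) p →L[ℝ] ℂ) (m : M) :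
    TangentSpace 𝓘(ℝ, E) m →ₗ[ℝ] TangentSpace 𝓘(ℝ, E) m →ₗ[ℝ] ℂ :=
  let φ : TangentSpace 𝓘(ℝ, E) m →L[ℝ] E := mfderiv 𝓘(ℝ, E) 𝓘(ℝ, E) (extChartAt 𝓘(ℝ, E) m) m
  let D : E →L[ℝ] E →L[ℝ] ℂ := fderiv ℝ (chartForm θ m) (extChartAt 𝓘(ℝ, E) m m)
  LinearMap.mk₂ ℝ (fun a b => D (φ a) (φ b) - D (φ b) (φ a))
    (fun a a' b => by simp only [map_add, add_apply]; ring)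
    (fun c a b => by simp only [map_smul, smul_apply, smul_sub])
    (fun a b b' => by simp only [map_add, add_apply]; ring)
    (fun c a b => by simp only [map_smul, smul_apply, smul_sub])

/-- The complex bilinear extension to `T^ℂ_m M` of a real bilinear form on `T_m M`. -/
def complexify {m : M}
    (B : TangentSpace 𝓘(ℝ, E) m →ₗ[ℝ] TangentSpace 𝓘(ℝ, E) m →ₗ[ℝ] ℂ) :
    CTangent E m →ₗ[ℂ] CTangent E m →ₗ[ℂ] ℂ :=
  LinearMap.liftBaseChange ℂ
    (((LinearMap.liftBaseChangeEquiv (M := TangentSpace 𝓘(ℝ, E) m) (N := ℂ)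
      ℂ).toLinearMap.restrictScalars ℝ) ∘ₗ B)

end Complexification

variable {𝔐 : Type*} [NormedAddCommGroup 𝔐] [InnerProductSpace ℂ 𝔐]
  {E : Type*} [NormedAddCommGroup E] [NormedSpace ℝ E]
  {M : Type*} [TopologicalSpace M] [ChartedSpace E M]

/-- A gauge (local trivialization) of a map `𝒦` into the projective space of `𝔐`: a smooth map
`K : Ω → 𝔐 ∖ {0}` on an open set `Ω` with `[K(m)] = 𝒦(m)`. Values of `K` outside `Ω` are
irrelevant. -/
structure Gauge (E : Type*) [NormedAddCommGroup E] [NormedSpace ℝ E]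
    [ChartedSpace E M] (𝒦 : M → ℙ ℂ 𝔐) where
  Ω : Set M
  isOpen : IsOpen Ω
  K : M → 𝔐
  smooth : ContMDiffOn 𝓘(ℝ, E) 𝓘(ℝ, 𝔐) ∞ K Ω
  ne_zero : ∀ m ∈ Ω, K m ≠ 0
  lifts : ∀ (m : M) (h : m ∈ Ω), Projectivization.mk ℂ (K m) (ne_zero m h) = 𝒦 m

/-- The fibre `L_m` of the line bundle `L = 𝒦^* 𝔼`, the pull-back of the universal bundle:
the line `𝒦(m) ⊂ 𝔐`. -/
abbrev L (𝒦 : M → ℙ ℂ 𝔐) (m : M) : Submodule ℂ 𝔐 := (𝒦 m).submodule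

/-- The fibre of the dual of the complex conjugate of `L`: the conjugate linear functionals
on `L_m`. -/
abbrev LBarDual (𝒦 : M → ℙ ℂ 𝔐) (m : M) : Type _ := L 𝒦 m →ₗ⋆[ℂ] ℂ

theorem Gauge.mem {𝒦 : M → ℙ ℂ 𝔐} (g : Gauge E 𝒦) {m : M} (h : m ∈ g.Ω) : g.K m ∈ L 𝒦 m := by
  have := g.lifts m h
  rw [L, ← this, Projectivization.submodule_mk]
  exact Submodule.mem_span_singleton_self _

open Classical in
/-- The basic section `s(m) = (m, K(m))` of `L` over `Ω` (extended by zero). -/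
def Gauge.sec {𝒦 : M → ℙ ℂ 𝔐} (g : Gauge E 𝒦) (m : M) : L 𝒦 m :=
  if h : m ∈ g.Ω then ⟨g.K m, g.mem h⟩ else 0

/-- The basic section `s̄^*` of the conjugate dual bundle: the conjugate linear functional with
value `1` on `s(m)`. -/
def Gauge.secBarDual {𝒦 : M → ℙ ℂ 𝔐} (g : Gauge E 𝒦) (m : M) : LBarDual 𝒦 m where
  toFun w := inner ℂ (w : 𝔐) (g.K m) / inner ℂ (g.K m) (g.K m)
  map_add' w w' := by simp [add_div]
  map_smul' c w := by simp; ring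

theorem Gauge.secBarDual_sec {𝒦 : M → ℙ ℂ 𝔐} (g : Gauge E 𝒦) {m : M} (h : m ∈ g.Ω) :
    g.secBarDual m (g.sec m) = 1 := by
  simp [Gauge.secBarDual, Gauge.sec, h, g.ne_zero m h]

/-- The connection `∇` of `L` induced by the Hermitian metric of `𝔐` (the pull-back of the
Fubini-Study connection): `∇_ξ s` is the orthogonal projection to `L_m` of the derivative of `s`,
regarded as a map into `𝔐`. -/
def connL (𝒦 : M → ℙ ℂ 𝔐) (s : Π p : M, L 𝒦 p) (m : M) (ξ : CTangent E m) : L 𝒦 m :=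
  (L 𝒦 m).orthogonalProjectionOnto (cderiv (fun p => (s p : 𝔐)) m ξ)

/-- The connection form `Θ = ⟨K|dK⟩ / ⟨K|K⟩` of `∇` in a gauge, on real tangent vectors. -/
def Gauge.ΘReal {𝒦 : M → ℙ ℂ 𝔐} (g : Gauge E 𝒦) (m : M) : TangentSpace 𝓘(ℝ, E) m →L[ℝ] ℂ :=
  (inner ℂ (g.K m) (g.K m))⁻¹ •
    ((innerSL ℂ (g.K m)).restrictScalars ℝ).comp (rderiv g.K m)

/-- The connection form `Θ` in a gauge, on complex tangent vectors. -/
def Gauge.Θ {𝒦 : M → ℙ ℂ 𝔐} (g : Gauge E 𝒦) (m : M) : CTangent E m →ₗ[ℂ] ℂ :=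
  LinearMap.liftBaseChange ℂ (g.ΘReal m : TangentSpace 𝓘(ℝ, E) m →ₗ[ℝ] ℂ)

theorem Gauge.Θ_apply {𝒦 : M → ℙ ℂ 𝔐} (g : Gauge E 𝒦) (m : M) (ξ : CTangent E m) :
    g.Θ m ξ = inner ℂ (g.K m) (cderiv g.K m ξ) / inner ℂ (g.K m) (g.K m) := by
  induction ξ using TensorProduct.induction_on with
  | zero => simp
  | tmul z v =>
    simp [Gauge.Θ, Gauge.ΘReal]
    ring
  | add x y hx hy => simp only [map_add, hx, hy, inner_add_right, add_div]

/-- `∇_ξ s = Θ(ξ) s` for the basic section of a gauge. -/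
theorem Gauge.connL_sec {𝒦 : M → ℙ ℂ 𝔐} (g : Gauge E 𝒦) {m : M} (h : m ∈ g.Ω)
    (ξ : CTangent E m) : connL 𝒦 g.sec m ξ = g.Θ m ξ • g.sec m := by
  have hev : (fun p => (g.sec p : 𝔐)) =ᶠ[𝓝 m] g.K := by
    filter_upwards [g.isOpen.mem_nhds h] with p hp
    simp [Gauge.sec, hp]
  have hL : L 𝒦 m = Submodule.span ℂ {g.K m} := by
    rw [L, ← g.lifts m h, Projectivization.submodule_mk]
  have hsec : (g.sec m : 𝔐) = g.K m := by simp [Gauge.sec, h]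
  rw [connL, cderiv_congr hev]
  apply Subtype.ext
  change (L 𝒦 m).starProjection _ = g.Θ m ξ • (g.sec m : 𝔐)
  rw [hsec, g.Θ_apply]
  refine Submodule.eq_starProjection_of_mem_orthogonal (Submodule.smul_mem _ _ (g.mem h)) ?_
  rw [hL, Submodule.mem_orthogonal_singleton_iff_inner_right, inner_sub_right, inner_smul_right,
    div_mul_cancel₀ _ (inner_self_ne_zero.mpr (g.ne_zero m h)), sub_self]

/-- The connection `∇̄^*` on the dual of the conjugate of `L`, computed in a gauge. By the Leibniz
rule for the pairing with sections of the conjugate of `L`,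
`(∇̄^*_ξ ψ)(s) = ξ(ψ(s)) - ψ(∇_ξ̄ s)`. -/
def Gauge.connLBarDual {𝒦 : M → ℙ ℂ 𝔐} (g : Gauge E 𝒦) (ψ : Π p : M, LBarDual 𝒦 p) (m : M)
    (ξ : CTangent E m) : LBarDual 𝒦 m :=
  (cderiv (fun p => ψ p (g.sec p)) m ξ - ψ m (connL 𝒦 g.sec m (conjT m ξ))) • g.secBarDual m

instance (𝒦 : M → ℙ ℂ 𝔐) : Nonempty (Gauge E 𝒦) :=
  ⟨⟨∅, isOpen_empty, 0, by simp [ContMDiffOn], by simp, by simp⟩⟩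

variable (E) in
/-- A chosen gauge of `𝒦` around `m` (if there is one). -/
def gaugeAt (𝒦 : M → ℙ ℂ 𝔐) (m : M) : Gauge E 𝒦 := Classical.epsilon fun g => m ∈ g.Ω

theorem mem_gaugeAt {𝒦 : M → ℙ ℂ 𝔐} (g : Gauge E 𝒦) {m : M} (h : m ∈ g.Ω) :
    m ∈ (gaugeAt E 𝒦 m).Ω :=
  Classical.epsilon_spec (p := fun g : Gauge E 𝒦 => m ∈ g.Ω) ⟨g, h⟩

/-- The connection `∇̄^*` on the dual of the conjugate of `L`; it does not depend on the chosen
gauge (on sections whose coefficient in a gauge is differentiable). -/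
def connLBarDual (𝒦 : M → ℙ ℂ 𝔐) (ψ : Π p : M, LBarDual 𝒦 p) (m : M) (ξ : CTangent E m) :
    LBarDual 𝒦 m :=
  (gaugeAt E 𝒦 m).connLBarDual ψ m ξ

theorem connLBarDual_add (𝒦 : M → ℙ ℂ 𝔐) (ψ : Π p : M, LBarDual 𝒦 p) (m : M)
    (ξ η : CTangent E m) :
    connLBarDual 𝒦 ψ m (ξ + η) = connLBarDual 𝒦 ψ m ξ + connLBarDual 𝒦 ψ m η := by
  simp only [connLBarDual, Gauge.connLBarDual, connL, map_add, ← add_smul]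
  congr 1; ring

theorem connLBarDual_smul (𝒦 : M → ℙ ℂ 𝔐) (ψ : Π p : M, LBarDual 𝒦 p) (m : M) (c : ℂ)
    (ξ : CTangent E m) :
    connLBarDual 𝒦 ψ m (c • ξ) = c • connLBarDual 𝒦 ψ m ξ := by
  simp only [connLBarDual, Gauge.connLBarDual, connL, LinearMap.map_smulₛₗ, map_smul, smul_smul]
  congr 1; simp; ring

/-- The map `I` from `𝔐` to sections of the conjugate dual of `L`,
`I(v)(m) = ⟨K(m)|v⟩ s̄^*(m)` in every gauge, i.e. `I(v)(m)(w) = ⟨w|v⟩` for `w ∈ L_m`. -/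
def IMap (𝒦 : M → ℙ ℂ 𝔐) : 𝔐 →ₗ[ℂ] (Π m : M, LBarDual 𝒦 m) where
  toFun v m :=
    { toFun := fun w => inner ℂ (w : 𝔐) v
      map_add' := fun w w' => by simp
      map_smul' := fun c w => by simp [mul_comm] }
  map_add' v v' := by ext m w; simp
  map_smul' c v := by ext m w; simp

theorem IMap_eq {𝒦 : M → ℙ ℂ 𝔐} (g : Gauge E 𝒦) {m : M} (h : m ∈ g.Ω) (v : 𝔐) :
    IMap 𝒦 v m = (inner ℂ (g.K m) v : ℂ) • g.secBarDual m := by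
  have hN : inner ℂ (g.K m) (g.K m) ≠ (0 : ℂ) := inner_self_ne_zero.mpr (g.ne_zero m h)
  ext w
  have hL : L 𝒦 m = Submodule.span ℂ {g.K m} := by
    rw [L, ← g.lifts m h, Projectivization.submodule_mk]
  obtain ⟨a, ha⟩ : ∃ a : ℂ, a • g.K m = (w : 𝔐) :=
    Submodule.mem_span_singleton.1 (hL.le w.2)
  change inner ℂ (w : 𝔐) v = inner ℂ (g.K m) v * (inner ℂ (w : 𝔐) (g.K m) / inner ℂ (g.K m) (g.K m))
  rw [← ha, inner_smul_left, inner_smul_left]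
  field_simp

/-- The smooth complex vector fields `X` with `∇̄^*_X ψ = 0` for all `ψ ∈ I(𝔐)`. -/
def annihilators [IsManifold 𝓘(ℝ, E) ∞ M] (𝒦 : M → ℙ ℂ 𝔐) : Set (Π m : M, CTangent E m) :=
  {X | IsSmoothField X ∧ ∀ ψ ∈ LinearMap.range (IMap 𝒦), ∀ m, connLBarDual 𝒦 ψ m (X m) = 0}

/-- The complex distribution `P`: `P_m` consists of the values at `m` of the smooth complex vector
fields that annihilate `I(𝔐)`. -/
def P [IsManifold 𝓘(ℝ, E) ∞ M] (𝒦 : M → ℙ ℂ 𝔐) (m : M) : Submodule ℂ (CTangent E m) where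
  carrier := {ξ | ∃ X ∈ annihilators 𝒦, X m = ξ}
  zero_mem' := ⟨0, ⟨isSmoothField_zero, fun ψ _ m => by
    simpa using connLBarDual_smul 𝒦 ψ m 0 (0 : CTangent E m)⟩, rfl⟩
  add_mem' := by
    rintro _ _ ⟨X, hX, rfl⟩ ⟨Y, hY, rfl⟩
    refine ⟨X + Y, ⟨hX.1.add hY.1, fun ψ hψ m => ?_⟩, rfl⟩
    rw [Pi.add_apply, connLBarDual_add, hX.2 ψ hψ, hY.2 ψ hψ, add_zero]
  smul_mem' := by
    rintro c _ ⟨X, hX, rfl⟩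
    refine ⟨c • X, ⟨hX.1.smul c, fun ψ hψ m => ?_⟩, rfl⟩
    rw [Pi.smul_apply, connLBarDual_smul, hX.2 ψ hψ, smul_zero]

/-- The complex conjugate `P̄` of `P`. -/
def PBar [IsManifold 𝓘(ℝ, E) ∞ M] (𝒦 : M → ℙ ℂ 𝔐) (m : M) : Submodule ℂ (CTangent E m) :=
  (P 𝒦 m).map (conjT m)

/-- The curvature form `i curv ∇ = i dΘ` in a gauge. -/
def Gauge.curvForm {𝒦 : M → ℙ ℂ 𝔐} (g : Gauge E 𝒦) (m : M) : CTangent E m →ₗ[ℂ] CTangent E m →ₗ[ℂ] ℂ :=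
  Complex.I • complexify (extDer g.ΘReal m)

variable (E) in
/-- The curvature form `ω = i curv ∇` of `L`; it does not depend on the chosen gauge. -/
def curvForm (𝒦 : M → ℙ ℂ 𝔐) (m : M) : CTangent E m →ₗ[ℂ] CTangent E m →ₗ[ℂ] ℂ :=
  (gaugeAt E 𝒦 m).curvForm m

/-! The connection and the curvature form do not depend on the gauge. -/

theorem rderiv_pair {F F' F'' : Type*} [NormedAddCommGroup F] [NormedSpace ℂ F]
    [NormedAddCommGroup F'] [NormedSpace ℂ F'] [NormedAddCommGroup F''] [NormedSpace ℂ F'']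
    {f : M → F} {h : M → F'} {m : M} (hf : MDifferentiableAt 𝓘(ℝ, E) 𝓘(ℝ, F) f m)
    (hh : MDifferentiableAt 𝓘(ℝ, E) 𝓘(ℝ, F') h m) {G : F × F' → F''} {G' : F × F' →L[ℝ] F''}
    (hG : HasFDerivAt G G' (f m, h m)) (v : TangentSpace 𝓘(ℝ, E) m) :
    rderiv (fun p => G (f p, h p)) m v = G' (rderiv (E := E) f m v, rderiv (E := E) h m v) := by
  have hp : HasMFDerivAt 𝓘(ℝ, E) 𝓘(ℝ, F × F') (fun p => (f p, h p)) m
      ((rderiv (E := E) f m).prod (rderiv (E := E) h m)) :=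
    ⟨hf.hasMFDerivAt.1.prodMk hh.hasMFDerivAt.1, hf.hasMFDerivAt.2.prodMk hh.hasMFDerivAt.2⟩
  have hG2 : HasMFDerivAt 𝓘(ℝ, F × F') 𝓘(ℝ, F'') G (f m, h m) G' := hG.hasMFDerivAt
  have := HasMFDerivAt.comp (g := G) m hG2 hp
  rw [rderiv]
  change mfderiv 𝓘(ℝ, E) 𝓘(ℝ, F'') (G ∘ fun p => (f p, h p)) m v = _
  rw [this.mfderiv]
  rfl

theorem Gauge.transition {𝒦 : M → ℙ ℂ 𝔐} (g g' : Gauge E 𝒦) {p : M} (h : p ∈ g.Ω)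
    (h' : p ∈ g'.Ω) :
    ∃ c : ℂ, c ≠ 0 ∧ g'.K p = c • g.K p := by
  have := (g'.lifts p h').trans (g.lifts p h).symm
  rw [Projectivization.mk_eq_mk_iff'] at this
  obtain ⟨c, hc⟩ := this
  refine ⟨c, ?_, hc.symm⟩
  rintro rfl
  exact g'.ne_zero p h' (by rw [← hc, zero_smul])

/-- The transition function of two gauges. -/
def Gauge.trans {𝒦 : M → ℙ ℂ 𝔐} (g g' : Gauge E 𝒦) (p : M) : ℂ :=
  inner ℂ (g.K p) (g'.K p) / inner ℂ (g.K p) (g.K p)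

theorem Gauge.trans_spec {𝒦 : M → ℙ ℂ 𝔐} (g g' : Gauge E 𝒦) {p : M} (h : p ∈ g.Ω)
    (h' : p ∈ g'.Ω) : g.trans g' p ≠ 0 ∧ g'.K p = g.trans g' p • g.K p := by
  obtain ⟨c, hc, e⟩ := g.transition g' h h'
  have : g.trans g' p = c := by
    rw [Gauge.trans, e, inner_smul_right,
      mul_div_cancel_right₀ _ (inner_self_ne_zero.mpr (g.ne_zero p h))]
  rw [this]
  exact ⟨hc, e⟩

theorem Gauge.contMDiffAt_trans {𝒦 : M → ℙ ℂ 𝔐} (g g' : Gauge E 𝒦) {p : M} (h : p ∈ g.Ω)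
    (h' : p ∈ g'.Ω) : ContMDiffAt 𝓘(ℝ, E) 𝓘(ℝ, ℂ) ∞ (g.trans g') p := by
  have hg := g.smooth.contMDiffAt (g.isOpen.mem_nhds h)
  have hg' := g'.smooth.contMDiffAt (g'.isOpen.mem_nhds h')
  have h1 := (contDiff_inner (𝕜 := ℂ) (E := 𝔐) (n := ∞)).comp_contMDiffAt (hg.prodMk_space hg')
  have h2 := (contDiff_inner (𝕜 := ℂ) (E := 𝔐) (n := ∞)).comp_contMDiffAt (hg.prodMk_space hg)
  have hN : inner ℂ (g.K p) (g.K p) ≠ (0 : ℂ) := inner_self_ne_zero.mpr (g.ne_zero p h)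
  have h3 := ContDiffAt.comp_contMDiffAt (x := p) (f := fun q => (inner ℂ (g.K q) (g.K q) : ℂ))
    (contDiffAt_inv ℝ (n := ∞) hN) h2
  have hm : ContDiff ℝ ∞ (fun z : ℂ × ℂ => z.1 * z.2) := contDiff_mul
  have h4 := hm.comp_contMDiffAt (h1.prodMk_space h3)
  exact h4

theorem Gauge.rderiv_trans {𝒦 : M → ℙ ℂ 𝔐} (g g' : Gauge E 𝒦) {p : M} (h : p ∈ g.Ω)
    (h' : p ∈ g'.Ω) (v : TangentSpace 𝓘(ℝ, E) p) :
    rderiv g'.K p v = g.trans g' p • rderiv (E := E) g.K p v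
      + rderiv (E := E) (g.trans g') p v • g.K p := by
  have hev : g'.K =ᶠ[𝓝 p] fun q => g.trans g' q • g.K q := by
    filter_upwards [g.isOpen.mem_nhds h, g'.isOpen.mem_nhds h'] with q hq hq'
    exact (g.trans_spec g' hq hq').2
  have hg := (g.smooth.contMDiffAt (g.isOpen.mem_nhds h)).mdifferentiableAt (by simp)
  have hc := (g.contMDiffAt_trans g' h h').mdifferentiableAt (by simp)
  have hb : HasFDerivAt (𝕜 := ℝ) (fun x : ℂ × 𝔐 => x.1 • x.2) _ (g.trans g' p, g.K p) :=
    hasFDerivAt_fst.smul hasFDerivAt_snd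
  have e : rderiv (E := E) g'.K p = rderiv (fun q => g.trans g' q • g.K q) p := by
    ext v; simp only [rderiv, hev.mfderiv_eq]
  rw [e]
  exact rderiv_pair hc hg hb v

theorem Gauge.ΘReal_trans {𝒦 : M → ℙ ℂ 𝔐} (g g' : Gauge E 𝒦) {p : M} (h : p ∈ g.Ω)
    (h' : p ∈ g'.Ω) :
    g'.ΘReal p = g.ΘReal p + (g.trans g' p)⁻¹ • rderiv (E := E) (g.trans g') p := by
  obtain ⟨hc, e⟩ := g.trans_spec g' h h'
  have hN : inner ℂ (g.K p) (g.K p) ≠ (0 : ℂ) := inner_self_ne_zero.mpr (g.ne_zero p h)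
  have hc' : conj (g.trans g' p) ≠ 0 := by simpa using hc
  ext v
  change (inner ℂ (g'.K p) (g'.K p))⁻¹ * inner ℂ (g'.K p) (rderiv (E := E) g'.K p v) =
    (inner ℂ (g.K p) (g.K p))⁻¹ * inner ℂ (g.K p) (rderiv (E := E) g.K p v) +
      (g.trans g' p)⁻¹ * rderiv (E := E) (g.trans g') p v
  rw [g.rderiv_trans g' h h' v, e]
  simp only [inner_smul_left, inner_smul_right, inner_add_right]
  field_simp

theorem Gauge.Θ_trans {𝒦 : M → ℙ ℂ 𝔐} (g g' : Gauge E 𝒦) {p : M} (h : p ∈ g.Ω)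
    (h' : p ∈ g'.Ω) (ξ : CTangent E p) :
    g'.Θ p ξ = g.Θ p ξ + (g.trans g' p)⁻¹ * cderiv (g.trans g') p ξ := by
  induction ξ using TensorProduct.induction_on with
  | zero => simp
  | tmul z v =>
    simp only [Gauge.Θ, LinearMap.liftBaseChange_tmul, g.ΘReal_trans g' h h', cderiv_tmul]
    simp
    ring
  | add x y hx hy => simp only [map_add, hx, hy]; ring

theorem Gauge.connLBarDual_eq {𝒦 : M → ℙ ℂ 𝔐} (g : Gauge E 𝒦) (ψ : Π p : M, LBarDual 𝒦 p)
    {m : M} (h : m ∈ g.Ω) (ξ : CTangent E m) :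
    g.connLBarDual ψ m ξ = (cderiv (fun p => ψ p (g.sec p)) m ξ
      - conj (g.Θ m (conjT m ξ)) * ψ m (g.sec m)) • g.secBarDual m := by
  rw [Gauge.connLBarDual, g.connL_sec h, LinearMap.map_smulₛₗ, smul_eq_mul]

theorem Gauge.connLBarDual_indep {𝒦 : M → ℙ ℂ 𝔐} (g g' : Gauge E 𝒦) (ψ : Π p : M, LBarDual 𝒦 p)
    {m : M} (h : m ∈ g.Ω) (h' : m ∈ g'.Ω)
    (hψ : MDifferentiableAt 𝓘(ℝ, E) 𝓘(ℝ, ℂ) (fun p => ψ p (g.sec p)) m) (ξ : CTangent E m) :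
    g'.connLBarDual ψ m ξ = g.connLBarDual ψ m ξ := by
  obtain ⟨hc, e⟩ := g.trans_spec g' h h'
  set c := g.trans g' with hcdef
  set f := fun p => ψ p (g.sec p) with hf
  have hc' : conj (c m) ≠ 0 := by simpa using hc
  have hsec : ∀ q ∈ g.Ω ∩ g'.Ω, g'.sec q = c q • g.sec q := by
    rintro q ⟨hq, hq'⟩
    apply Subtype.ext
    simp [Gauge.sec, hq, hq', (g.trans_spec g' hq hq').2, hcdef]
  have hev : (fun p => ψ p (g'.sec p)) =ᶠ[𝓝 m] fun p => conj (c p) * f p := by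
    filter_upwards [g.isOpen.mem_nhds h, g'.isOpen.mem_nhds h'] with q hq hq'
    rw [hsec q ⟨hq, hq'⟩, LinearMap.map_smulₛₗ, smul_eq_mul]
  have hcd := (g.contMDiffAt_trans g' h h').mdifferentiableAt (by simp)
  have hr : ∀ v : TangentSpace 𝓘(ℝ, E) m, rderiv (fun p => conj (c p) * f p) m v =
      conj (c m) * rderiv (E := E) f m v + conj (rderiv (E := E) c m v) * f m := by
    intro v
    have hb : HasFDerivAt (𝕜 := ℝ) (fun x : ℂ × ℂ => conj x.1 * x.2) _ (c m, f m) :=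
      ((Complex.conjCLE.toContinuousLinearMap.hasFDerivAt).comp (c m, f m)
        (hasFDerivAt_fst (𝕜 := ℝ) (E := ℂ) (F := ℂ))).mul hasFDerivAt_snd
    refine (rderiv_pair hcd hψ hb v).trans ?_
    change conj (c m) * rderiv (E := E) f m v + f m * conj (rderiv (E := E) c m v) = _
    ring
  have hC : cderiv (fun p => conj (c p) * f p) m ξ =
      conj (c m) * cderiv (E := E) f m ξ + conj (cderiv (E := E) c m (conjT m ξ)) * f m := by
    induction ξ using TensorProduct.induction_on with
    | zero => simp
    | tmul z v => simp only [conjT_tmul, cderiv_tmul, hr]; simp; ring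
    | add x y hx hy => simp only [map_add, hx, hy]; ring
  have hs : g'.secBarDual m = (conj (c m))⁻¹ • g.secBarDual m := by
    ext w
    change inner ℂ (w : 𝔐) (g'.K m) / inner ℂ (g'.K m) (g'.K m) =
      (conj (c m))⁻¹ * (inner ℂ (w : 𝔐) (g.K m) / inner ℂ (g.K m) (g.K m))
    have hN : inner ℂ (g.K m) (g.K m) ≠ (0 : ℂ) := inner_self_ne_zero.mpr (g.ne_zero m h)
    rw [e]
    simp only [inner_smul_left, inner_smul_right]
    field_simp
  rw [g.connLBarDual_eq ψ h, g'.connLBarDual_eq ψ h', cderiv_congr hev, hC, hs, smul_smul,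
    hsec m ⟨h, h'⟩, LinearMap.map_smulₛₗ, g.Θ_trans g' h h']
  congr 1
  simp only [map_add, map_mul, map_inv₀, smul_eq_mul, ← hcdef]
  change _ = cderiv f m ξ - conj (g.Θ m (conjT m ξ)) * f m
  field_simp
  ring

/-- The connection `∇̄^*` may be computed in any gauge. -/
theorem connLBarDual_eq {𝒦 : M → ℙ ℂ 𝔐} (g : Gauge E 𝒦) (ψ : Π p : M, LBarDual 𝒦 p)
    {m : M} (h : m ∈ g.Ω)
    (hψ : MDifferentiableAt 𝓘(ℝ, E) 𝓘(ℝ, ℂ) (fun p => ψ p (g.sec p)) m) (ξ : CTangent E m) :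
    connLBarDual 𝒦 ψ m ξ = g.connLBarDual ψ m ξ :=
  g.connLBarDual_indep _ ψ h (mem_gaugeAt g h) hψ ξ

theorem extDer_congr_of_eventuallyEq {θ θ' : Π p : M, TangentSpace 𝓘(ℝ, E) p →L[ℝ] ℂ} {m : M}
    (h : ∀ᶠ p in 𝓝 m, θ p = θ' p) : extDer θ m = extDer θ' m := by
  have : chartForm θ m =ᶠ[𝓝 (extChartAt 𝓘(ℝ, E) m m)] chartForm θ' m := by
    have ht := (continuousAt_extChartAt_symm (I := 𝓘(ℝ, E)) m).tendsto
    rw [extChartAt_to_inv] at ht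
    filter_upwards [ht.eventually h] with y hy
    simp only [chartForm, hy]
  simp only [extDer, this.fderiv_eq]

section

variable [IsManifold 𝓘(ℝ, E) ∞ M]

/-- The chart expression of `df`. -/
theorem chartForm_eventuallyEq {F : Type*} [NormedAddCommGroup F] [NormedSpace ℂ F]
    {f : M → F} {m : M} (hf : ContMDiffAt 𝓘(ℝ, E) 𝓘(ℝ, F) ∞ f m) :
    ∀ᶠ y in 𝓝 (extChartAt 𝓘(ℝ, E) m m),
      (rderiv f ((extChartAt 𝓘(ℝ, E) m).symm y)).comp
        (mfderiv 𝓘(ℝ, E) 𝓘(ℝ, E) (extChartAt 𝓘(ℝ, E) m).symm y) =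
      fderiv ℝ (f ∘ (extChartAt 𝓘(ℝ, E) m).symm) y := by
  have h1 : ∀ᶠ p in 𝓝 m, ContMDiffAt 𝓘(ℝ, E) 𝓘(ℝ, F) 1 f p :=
    have : IsManifold 𝓘(ℝ, E) 1 M := .of_le (n := ∞) (by simp)
    (contMDiffAt_iff_contMDiffAt_nhds (by simp)).1 (hf.of_le (by simp))
  have ht := (continuousAt_extChartAt_symm (I := 𝓘(ℝ, E)) m).tendsto
  rw [extChartAt_to_inv] at ht
  filter_upwards [ht.eventually h1, extChartAt_target_mem_nhds (I := 𝓘(ℝ, E)) m] with y hy hy'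
  rw [← mfderiv_eq_fderiv]
  have h2 : MDifferentiableAt 𝓘(ℝ, E) 𝓘(ℝ, E) (extChartAt 𝓘(ℝ, E) m).symm y :=
    ((contMDiffOn_extChartAt_symm (I := 𝓘(ℝ, E)) (n := ∞) m).contMDiffAt
      ((isOpen_extChartAt_target m).mem_nhds hy')).mdifferentiableAt (by simp)
  exact (mfderiv_comp y (hy.mdifferentiableAt one_ne_zero) h2).symm

theorem Gauge.curvForm_indep {𝒦 : M → ℙ ℂ 𝔐} (g g' : Gauge E 𝒦) {m : M} (h : m ∈ g.Ω)
    (h' : m ∈ g'.Ω) : g'.curvForm m = g.curvForm m := by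
  rw [Gauge.curvForm, Gauge.curvForm]
  congr 2
  have hev : ∀ᶠ p in 𝓝 m,
      g'.ΘReal p = g.ΘReal p + (g.trans g' p)⁻¹ • rderiv (E := E) (g.trans g') p := by
    filter_upwards [g.isOpen.mem_nhds h, g'.isOpen.mem_nhds h'] with q hq hq'
    exact g.ΘReal_trans g' hq hq'
  rw [extDer_congr_of_eventuallyEq hev]
  have hcm := g.contMDiffAt_trans g' h h'
  have hKm := g.smooth.contMDiffAt (g.isOpen.mem_nhds h)
  set φ := extChartAt 𝓘(ℝ, E) m with hφ
  set γ : E → ℂ := g.trans g' ∘ φ.symm with hγ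
  set κ : E → 𝔐 := g.K ∘ φ.symm with hκ
  have hinv : φ.symm (φ m) = m := extChartAt_to_inv m
  have hφs : ContMDiffAt 𝓘(ℝ, E) 𝓘(ℝ, E) ∞ φ.symm (φ m) :=
    (contMDiffOn_extChartAt_symm (I := 𝓘(ℝ, E)) (n := ∞) m).contMDiffAt
      (extChartAt_target_mem_nhds (I := 𝓘(ℝ, E)) m)
  have hγd : ContDiffAt ℝ ∞ γ (φ m) :=
    contMDiffAt_iff_contDiffAt.1 (ContMDiffAt.comp (φ m) (by rwa [hinv]) hφs)
  have hκd : ContDiffAt ℝ ∞ κ (φ m) :=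
    contMDiffAt_iff_contDiffAt.1 (ContMDiffAt.comp (φ m) (by rwa [hinv]) hφs)
  have hγ0 : γ (φ m) ≠ 0 := by
    simp only [hγ, Function.comp_apply, hinv]; exact (g.trans_spec g' h h').1
  have hκ0 : κ (φ m) ≠ 0 := by
    simp only [hκ, Function.comp_apply, hinv]; exact g.ne_zero m h
  have e1 : chartForm g.ΘReal m =ᶠ[𝓝 (φ m)] fun y =>
      (inner ℂ (κ y) (κ y) : ℂ)⁻¹ • ((innerSL ℂ (κ y)).restrictScalars ℝ).comp (fderiv ℝ κ y) := by
    filter_upwards [chartForm_eventuallyEq hKm] with y hy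
    rw [← hy]
    rfl
  have e2 : chartForm (fun p => g.ΘReal p + (g.trans g' p)⁻¹ • rderiv (E := E) (g.trans g') p) m
      =ᶠ[𝓝 (φ m)] fun y => chartForm g.ΘReal m y + (γ y)⁻¹ • fderiv ℝ γ y := by
    filter_upwards [chartForm_eventuallyEq hcm] with y hy
    rw [← hy]
    rfl
  have d1 : DifferentiableAt ℝ (chartForm g.ΘReal m) (φ m) := by
    rw [e1.differentiableAt_iff]
    have hκ1 : DifferentiableAt ℝ κ (φ m) := hκd.differentiableAt (by simp)
    have hκ2 : DifferentiableAt ℝ (fderiv ℝ κ) (φ m) :=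
      (hκd.fderiv_right (m := 1) (by exact WithTop.coe_le_coe.2 le_top)).differentiableAt (by simp)
    refine DifferentiableAt.smul ((hκ1.inner ℂ hκ1).inv (inner_self_ne_zero.mpr hκ0)) ?_
    refine DifferentiableAt.clm_comp ?_ hκ2
    exact (isBoundedBilinearMap_inner (𝕜 := ℂ) (E := 𝔐)).toContinuousLinearMap.differentiableAt.comp
      (φ m) hκ1
  have dγ : DifferentiableAt ℝ γ (φ m) := hγd.differentiableAt (by simp)
  have dγ2 : DifferentiableAt ℝ (fderiv ℝ γ) (φ m) :=
    (hγd.fderiv_right (m := 1) (by exact WithTop.coe_le_coe.2 le_top)).differentiableAt (by simp)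
  have hD := e2.fderiv_eq.trans (fderiv_fun_add d1 ((dγ.inv hγ0).smul dγ2))
  have hsymm : IsSymmSndFDerivAt ℝ γ (φ m) := hγd.isSymmSndFDerivAt (by simp; exact WithTop.coe_le_coe.2 le_top)
  ext a b
  simp only [extDer, LinearMap.mk₂_apply]
  erw [hD, fderiv_fun_smul (dγ.inv hγ0) dγ2]
  set α : E := mfderiv 𝓘(ℝ, E) 𝓘(ℝ, E) (extChartAt 𝓘(ℝ, E) m) m a
  set β : E := mfderiv 𝓘(ℝ, E) 𝓘(ℝ, E) (extChartAt 𝓘(ℝ, E) m) m b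
  have hi : ∀ u : E, fderiv ℝ (γ⁻¹) (φ m) u = -(γ (φ m) ^ 2)⁻¹ * fderiv ℝ γ (φ m) u := by
    intro u
    have := (hasFDerivAt_inv' (𝕜 := ℝ) hγ0).comp (φ m) dγ.hasFDerivAt
    rw [show γ⁻¹ = Inv.inv ∘ γ from rfl, this.fderiv]
    simp
    ring
  have hs := hsymm.eq α β
  change (fderiv ℝ (chartForm g.ΘReal m) (φ m) α β + ((γ (φ m))⁻¹ * fderiv ℝ (fderiv ℝ γ) (φ m) α β
      + fderiv ℝ (γ⁻¹) (φ m) α * fderiv ℝ γ (φ m) β)) -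
    (fderiv ℝ (chartForm g.ΘReal m) (φ m) β α + ((γ (φ m))⁻¹ * fderiv ℝ (fderiv ℝ γ) (φ m) β α
      + fderiv ℝ (γ⁻¹) (φ m) β * fderiv ℝ γ (φ m) α)) =
    fderiv ℝ (chartForm g.ΘReal m) (φ m) α β - fderiv ℝ (chartForm g.ΘReal m) (φ m) β α
  rw [hi, hi, hs]
  ring

/-- The curvature form may be computed in any gauge. -/
theorem curvForm_eq {𝒦 : M → ℙ ℂ 𝔐} (g : Gauge E 𝒦) {m : M} (h : m ∈ g.Ω) :
    curvForm E 𝒦 m = g.curvForm m :=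
  g.curvForm_indep _ h (mem_gaugeAt g h)

end

end CoherentMap

end

open CoherentMap

/-! Everything is governed by the component `g.perp m ξ = ξ(K) - Θ(ξ)K` of the derivative of a lift
orthogonal to its line. Write π(ξ) for it and N for ⟨K|K⟩. Two pointwise formulas carry the proof.

The first is ∇̄^*_ξ I(v) = ⟨π(ξ̄)|v⟩ s̄^* (`Gauge.connLBarDual_IMap`). Taking v = π(ξ̄) shows that ξ
annihilates I(𝔐) exactly when π(ξ̄) = 0, which is the criterion of part 1.

The second is ω(ξ,η) = i N⁻¹ (⟨π(ξ̄)|π(η)⟩ - ⟨π(η̄)|π(ξ)⟩) (`Gauge.curvForm_apply`). For ξ, η in P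
both terms vanish, so P is isotropic. For ξ in P ∩ P̄ both π(ξ) and π(ξ̄) vanish, so ω(ξ,·) = 0. For
ξ in P and η = ξ̄ only the second term survives, and iω(ξ,ξ̄) = ‖π(ξ)‖²/N.

Involutivity is the remaining point. If X̄(K) and Ȳ(K) are multiples of K on all of Ω,
differentiating these identities shows that the commutator of X̄ and Ȳ also maps K to a multiple of
K (`Gauge.perp_cbracket`). This needs brackets of fields to act as commutators of derivations on
𝔐-valued functions (`cderiv_cbracket`) and to commute with conjugation (`conjT_cbracket`). -/

namespace CoherentMap

/-! ### Lie brackets of real vector fields as commutators of derivations, via charts. -/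

section Calculus

variable {E : Type*} [NormedAddCommGroup E] [NormedSpace ℝ E]
  {M : Type*} [TopologicalSpace M] [ChartedSpace E M] [IsManifold 𝓘(ℝ, E) ∞ M]
  {F : Type*} [NormedAddCommGroup F] [NormedSpace ℂ F]

theorem mdifferentiableAt_extChartAt_symm_self (m : M) :
    MDifferentiableAt 𝓘(ℝ, E) 𝓘(ℝ, E) (extChartAt 𝓘(ℝ, E) m).symm (extChartAt 𝓘(ℝ, E) m m) :=
  ((contMDiffOn_extChartAt_symm (I := 𝓘(ℝ, E)) (n := ∞) m).contMDiffAt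
    (extChartAt_target_mem_nhds (I := 𝓘(ℝ, E)) m)).mdifferentiableAt (by simp)

/-- The derivative of a function is computed by its expression in the preferred chart. -/
theorem rderiv_eq_fderiv_chart {f : M → F} {m : M}
    (hf : MDifferentiableAt 𝓘(ℝ, E) 𝓘(ℝ, F) f m) (w : TangentSpace 𝓘(ℝ, E) m) :
    rderiv f m w = fderiv ℝ (f ∘ (extChartAt 𝓘(ℝ, E) m).symm) (extChartAt 𝓘(ℝ, E) m m)
      (mfderiv 𝓘(ℝ, E) 𝓘(ℝ, E) (extChartAt 𝓘(ℝ, E) m) m w) := by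
  have : IsManifold 𝓘(ℝ, E) 1 M := .of_le (n := ∞) (by simp)
  set φ := extChartAt 𝓘(ℝ, E) m with hφ
  have hinv : φ.symm (φ m) = m := extChartAt_to_inv m
  have h1 : MDifferentiableAt 𝓘(ℝ, E) 𝓘(ℝ, F) (f ∘ φ.symm) (φ m) :=
    MDifferentiableAt.comp (φ m) (by rwa [hinv]) (mdifferentiableAt_extChartAt_symm_self m)
  have h2 : MDifferentiableAt 𝓘(ℝ, E) 𝓘(ℝ, E) φ m := mdifferentiableAt_extChartAt (mem_chart_source E m)
  have hev : f =ᶠ[𝓝 m] (f ∘ φ.symm) ∘ φ := by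
    filter_upwards [extChartAt_source_mem_nhds (I := 𝓘(ℝ, E)) m] with p hp
    rw [Function.comp_apply, Function.comp_apply, φ.left_inv hp]
  rw [rderiv, hev.mfderiv_eq, mfderiv_comp m h1 h2, mfderiv_eq_fderiv]
  rfl

/-- In the preferred chart, the derivative of `f` along `V` is the derivative of the chart
expression of `f` along the chart expression of `V`. -/
theorem eventually_fderiv_mpullback {f : M → F} {m : M}
    (hf : ContMDiffAt 𝓘(ℝ, E) 𝓘(ℝ, F) ∞ f m) (V : Π p : M, TangentSpace 𝓘(ℝ, E) p) :
    (fun y => fderiv ℝ (f ∘ (extChartAt 𝓘(ℝ, E) m).symm) y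
        (VectorField.mpullback 𝓘(ℝ, E) 𝓘(ℝ, E) (extChartAt 𝓘(ℝ, E) m).symm V y))
      =ᶠ[𝓝 (extChartAt 𝓘(ℝ, E) m m)]
      (fun p => rderiv f p (V p)) ∘ (extChartAt 𝓘(ℝ, E) m).symm := by
  have : IsManifold 𝓘(ℝ, E) 1 M := .of_le (n := ∞) (by simp)
  filter_upwards [chartForm_eventuallyEq hf, extChartAt_target_mem_nhds (I := 𝓘(ℝ, E)) m]
    with y hy hy'
  have hinv := isInvertible_mfderivWithin_extChartAt_symm (I := 𝓘(ℝ, E)) hy'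
  rw [ModelWithCorners.range_eq_univ, mfderivWithin_univ] at hinv
  rw [← hy, VectorField.mpullback_apply]
  change rderiv f _ (mfderiv 𝓘(ℝ, E) 𝓘(ℝ, E) (extChartAt 𝓘(ℝ, E) m).symm y
    ((mfderiv 𝓘(ℝ, E) 𝓘(ℝ, E) (extChartAt 𝓘(ℝ, E) m).symm y).inverse _)) = _
  rw [hinv.self_apply_inverse]
  rfl

variable [CompleteSpace E]

theorem differentiableAt_mpullback_chart {V : Π p : M, TangentSpace 𝓘(ℝ, E) p} {m : M}
    (hV : MDifferentiableAt 𝓘(ℝ, E) 𝓘(ℝ, E).tangent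
      (fun p => (⟨p, V p⟩ : TangentBundle 𝓘(ℝ, E) M)) m) :
    DifferentiableAt ℝ (VectorField.mpullback 𝓘(ℝ, E) 𝓘(ℝ, E) (extChartAt 𝓘(ℝ, E) m).symm V)
      (extChartAt 𝓘(ℝ, E) m m) := by
  have : IsManifold 𝓘(ℝ, E) 2 M := .of_le (n := ∞) (by exact WithTop.coe_le_coe.2 le_top)
  have := MDifferentiableWithinAt.differentiableWithinAt_mpullbackWithin_vectorField
    (s := Set.univ) hV.mdifferentiableWithinAt
  rw [ModelWithCorners.range_eq_univ, VectorField.mpullbackWithin_univ, Set.preimage_univ,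
    Set.inter_univ] at this
  exact differentiableWithinAt_univ.1 this

/-- In the chart this function is the derivative of a smooth map evaluated on a differentiable
field. It makes the outer derivatives in the commutator formula legitimate. -/
theorem mdifferentiableAt_rderiv_apply {f : M → F} {m : M}
    (hf : ContMDiffAt 𝓘(ℝ, E) 𝓘(ℝ, F) ∞ f m) {V : Π p : M, TangentSpace 𝓘(ℝ, E) p}
    (hV : MDifferentiableAt 𝓘(ℝ, E) 𝓘(ℝ, E).tangent
      (fun p => (⟨p, V p⟩ : TangentBundle 𝓘(ℝ, E) M)) m) :
    MDifferentiableAt 𝓘(ℝ, E) 𝓘(ℝ, F) (fun p => rderiv f p (V p)) m := by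
  have : IsManifold 𝓘(ℝ, E) 1 M := .of_le (n := ∞) (by simp)
  set φ := extChartAt 𝓘(ℝ, E) m with hφ
  have hφs := (contMDiffOn_extChartAt_symm (I := 𝓘(ℝ, E)) (n := ∞) m).contMDiffAt
      (extChartAt_target_mem_nhds (I := 𝓘(ℝ, E)) m)
  have hfd : ContDiffAt ℝ ∞ (f ∘ φ.symm) (φ m) :=
    contMDiffAt_iff_contDiffAt.1
      (ContMDiffAt.comp (φ m) (by rwa [hφ, extChartAt_to_inv]) hφs)
  have h1 : DifferentiableAt ℝ ((fun p => rderiv f p (V p)) ∘ φ.symm) (φ m) := by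
    rw [← (eventually_fderiv_mpullback hf V).differentiableAt_iff]
    exact ((hfd.fderiv_right (m := 1) (by exact WithTop.coe_le_coe.2 le_top)).differentiableAt
      (by simp)).clm_apply (differentiableAt_mpullback_chart hV)
  have h2 : MDifferentiableAt 𝓘(ℝ, E) 𝓘(ℝ, E) φ m :=
    mdifferentiableAt_extChartAt (mem_chart_source E m)
  refine (h1.mdifferentiableAt.comp m h2).congr_of_eventuallyEq ?_
  filter_upwards [extChartAt_source_mem_nhds (I := 𝓘(ℝ, E)) m] with p hp
  simp only [Function.comp_apply]
  rw [φ.left_inv hp]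

/-- The derivation along the Lie bracket is the commutator of the derivations. -/
theorem rderiv_mlieBracket {f : M → F} {m : M}
    (hf : ContMDiffAt 𝓘(ℝ, E) 𝓘(ℝ, F) ∞ f m) {V W : Π p : M, TangentSpace 𝓘(ℝ, E) p}
    (hV : MDifferentiableAt 𝓘(ℝ, E) 𝓘(ℝ, E).tangent
      (fun p => (⟨p, V p⟩ : TangentBundle 𝓘(ℝ, E) M)) m)
    (hW : MDifferentiableAt 𝓘(ℝ, E) 𝓘(ℝ, E).tangent
      (fun p => (⟨p, W p⟩ : TangentBundle 𝓘(ℝ, E) M)) m) :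
    rderiv f m (VectorField.mlieBracket 𝓘(ℝ, E) V W m) =
      rderiv (fun p => rderiv (E := E) f p (W p)) m (V m) -
        rderiv (fun p => rderiv (E := E) f p (V p)) m (W m) := by
  have : IsManifold 𝓘(ℝ, E) 1 M := .of_le (n := ∞) (by simp)
  set φ := extChartAt 𝓘(ℝ, E) m with hφ
  have hφs := (contMDiffOn_extChartAt_symm (I := 𝓘(ℝ, E)) (n := ∞) m).contMDiffAt
      (extChartAt_target_mem_nhds (I := 𝓘(ℝ, E)) m)
  have hfd : ContDiffAt ℝ ∞ (f ∘ φ.symm) (φ m) :=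
    contMDiffAt_iff_contDiffAt.1
      (ContMDiffAt.comp (φ m) (by rwa [hφ, extChartAt_to_inv]) hφs)
  have hinv : (mfderiv 𝓘(ℝ, E) 𝓘(ℝ, E) φ m).IsInvertible :=
    isInvertible_mfderiv_extChartAt (mem_extChartAt_source m)
  -- Pulling U back by `φ.symm` and then by `φ` returns U near m; applying the invertible
  -- differential of `φ` at m gives this.
  have hpull : ∀ U : Π p : M, TangentSpace 𝓘(ℝ, E) p,
      mfderiv 𝓘(ℝ, E) 𝓘(ℝ, E) φ m (U m) =
        VectorField.mpullback 𝓘(ℝ, E) 𝓘(ℝ, E) φ.symm U (φ m) := by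
    intro U
    have h := (VectorField.eventuallyEq_mpullback_mpullbackWithin_extChartAt
      (s := Set.univ) (I := 𝓘(ℝ, E)) (x := m) U).self_of_nhdsWithin (Set.mem_univ m)
    rw [ModelWithCorners.range_eq_univ, VectorField.mpullbackWithin_univ,
      VectorField.mpullback_apply] at h
    rw [h]
    exact hinv.self_apply_inverse _
  -- The bracket on the manifold is by definition the chart bracket transported by the inverse of
  -- this differential.
  have hbr : mfderiv 𝓘(ℝ, E) 𝓘(ℝ, E) φ m (VectorField.mlieBracket 𝓘(ℝ, E) V W m) =
      VectorField.lieBracket ℝ (VectorField.mpullback 𝓘(ℝ, E) 𝓘(ℝ, E) φ.symm V)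
        (VectorField.mpullback 𝓘(ℝ, E) 𝓘(ℝ, E) φ.symm W) (φ m) := by
    rw [← VectorField.mlieBracketWithin_univ, VectorField.mlieBracketWithin_apply]
    simp only [ModelWithCorners.range_eq_univ, VectorField.mpullbackWithin_univ,
      Set.preimage_univ, Set.inter_univ]
    refine (hinv.self_apply_inverse _).trans ?_
    exact congrFun (VectorField.lieBracketWithin_univ (𝕜 := ℝ) (E := E)) _
  rw [rderiv_eq_fderiv_chart (hf.mdifferentiableAt (by simp)),
    rderiv_eq_fderiv_chart (mdifferentiableAt_rderiv_apply hf hW),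
    rderiv_eq_fderiv_chart (mdifferentiableAt_rderiv_apply hf hV),
    ← (eventually_fderiv_mpullback hf V).fderiv_eq,
    ← (eventually_fderiv_mpullback hf W).fderiv_eq, hbr, hpull V, hpull W]
  exact VectorField.fderiv_apply_lieBracket hfd (by simp; exact WithTop.coe_le_coe.2 le_top)
    (differentiableAt_mpullback_chart hW) (differentiableAt_mpullback_chart hV)

end Calculus

end CoherentMap

/-! ### The orthogonal component of the derivative of a lift, and the connection and curvature in
terms of it. -/

namespace CoherentMap

variable {𝔐 : Type*} [NormedAddCommGroup 𝔐] [InnerProductSpace ℂ 𝔐]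
  {E : Type*} [NormedAddCommGroup E] [NormedSpace ℝ E]
  {M : Type*} [TopologicalSpace M] [ChartedSpace E M]

theorem conjT_mkC {m : M} (a b : TangentSpace 𝓘(ℝ, E) m) : conjT m (mkC a b) = mkC a (-b) := by
  simp [mkC, TensorProduct.neg_tmul, TensorProduct.tmul_neg]

theorem conjT_conjT {m : M} (ξ : CTangent E m) : conjT m (conjT m ξ) = ξ := by
  induction ξ using TensorProduct.induction_on with
  | zero => simp
  | tmul z v => simp
  | add x y hx hy => simp only [map_add, hx, hy]

theorem cderiv_mkC {F : Type*} [NormedAddCommGroup F] [NormedSpace ℂ F] (f : M → F) {m : M}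
    (a b : TangentSpace 𝓘(ℝ, E) m) :
    cderiv f m (mkC a b) = rderiv (E := E) f m a + Complex.I • rderiv (E := E) f m b := by
  simp [mkC]

@[simp] theorem complexify_tmul {m : M}
    (B : TangentSpace 𝓘(ℝ, E) m →ₗ[ℝ] TangentSpace 𝓘(ℝ, E) m →ₗ[ℝ] ℂ) (z w : ℂ)
    (a b : TangentSpace 𝓘(ℝ, E) m) :
    complexify B (z ⊗ₜ[ℝ] a) (w ⊗ₜ[ℝ] b) = z * w * B a b := by
  simp [complexify, mul_assoc]

/-- The component of `ξ(K)` orthogonal to the line of `K`. -/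
noncomputable def Gauge.perp {𝒦 : M → ℙ ℂ 𝔐} (g : Gauge E 𝒦) (m : M) : CTangent E m →ₗ[ℂ] 𝔐 :=
  cderiv g.K m - (g.Θ m).smulRight (g.K m)

theorem Gauge.perp_apply {𝒦 : M → ℙ ℂ 𝔐} (g : Gauge E 𝒦) (m : M) (ξ : CTangent E m) :
    g.perp m ξ = cderiv g.K m ξ - g.Θ m ξ • g.K m := rfl

/-- Projecting off K removes the product of the K-components. The expanded form is what
differentiating Θ produces. -/
theorem Gauge.inner_perp_perp {𝒦 : M → ℙ ℂ 𝔐} (g : Gauge E 𝒦) {m : M} (h : m ∈ g.Ω)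
    (ξ η : CTangent E m) :
    inner ℂ (g.perp m ξ) (g.perp m η) = inner ℂ (cderiv g.K m ξ) (cderiv g.K m η) -
      inner ℂ (cderiv g.K m ξ) (g.K m) * inner ℂ (g.K m) (cderiv g.K m η) /
        inner ℂ (g.K m) (g.K m) := by
  have hN : inner ℂ (g.K m) (g.K m) ≠ (0 : ℂ) := inner_self_ne_zero.mpr (g.ne_zero m h)
  simp only [g.perp_apply, inner_sub_left, inner_sub_right, inner_smul_left, inner_smul_right,
    g.Θ_apply, map_div₀, inner_conj_symm]
  field_simp
  ring

/-- Pairing with K forces the factor c to be Θ(ξ), so being any multiple of K suffices. -/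
theorem Gauge.perp_eq_zero_of_cderiv_eq {𝒦 : M → ℙ ℂ 𝔐} (g : Gauge E 𝒦) {m : M} (h : m ∈ g.Ω)
    {ξ : CTangent E m} {c : ℂ} (hc : cderiv g.K m ξ = c • g.K m) : g.perp m ξ = 0 := by
  have hN : inner ℂ (g.K m) (g.K m) ≠ (0 : ℂ) := inner_self_ne_zero.mpr (g.ne_zero m h)
  rw [g.perp_apply, g.Θ_apply, hc, inner_smul_right, mul_div_cancel_right₀ _ hN, sub_self]

/-- The coefficient ⟨K|v⟩ is conjugate linear in K, so its derivative along ξ is ⟨ξ̄(K)|v⟩. The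
connection term subtracts the conjugate of Θ(ξ̄) times ⟨K|v⟩, which turns ξ̄(K) into its orthogonal
component. -/
theorem Gauge.connLBarDual_IMap {𝒦 : M → ℙ ℂ 𝔐} (g : Gauge E 𝒦) {m : M} (h : m ∈ g.Ω) (v : 𝔐)
    (ξ : CTangent E m) :
    CoherentMap.connLBarDual 𝒦 (IMap 𝒦 v) m ξ =
      (inner ℂ (g.perp m (conjT m ξ)) v : ℂ) • g.secBarDual m := by
  have hK := (g.smooth.contMDiffAt (g.isOpen.mem_nhds h)).mdifferentiableAt
    (by simp : (∞ : WithTop ℕ∞) ≠ 0)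
  have hsec : ∀ p ∈ g.Ω, IMap 𝒦 v p (g.sec p) = inner ℂ (g.K p) v := fun p hp => by
    change inner ℂ (g.sec p : 𝔐) v = _
    simp [Gauge.sec, hp]
  have hev : (fun p => IMap 𝒦 v p (g.sec p)) =ᶠ[𝓝 m] fun p => inner ℂ (g.K p) v := by
    filter_upwards [g.isOpen.mem_nhds h] with p hp using hsec p hp
  have hv : MDifferentiableAt 𝓘(ℝ, E) 𝓘(ℝ, 𝔐) (fun _ : M => v) m := mdifferentiableAt_const
  have hb : HasFDerivAt (𝕜 := ℝ) (fun x : 𝔐 × 𝔐 => (inner ℂ x.1 x.2 : ℂ)) _ (g.K m, v) :=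
    hasFDerivAt_fst.inner ℂ hasFDerivAt_snd
  have hr : ∀ w : TangentSpace 𝓘(ℝ, E) m, rderiv (fun p => (inner ℂ (g.K p) v : ℂ)) m w =
      inner ℂ (rderiv (E := E) g.K m w) v := fun w => by
    have h0 : rderiv (E := E) (fun _ : M => v) m w = 0 := by rw [rderiv, mfderiv_const]; rfl
    refine (rderiv_pair hK hv hb w).trans ?_
    rw [h0]
    simp
  have hC : cderiv (fun p => (inner ℂ (g.K p) v : ℂ)) m ξ =
      inner ℂ (cderiv g.K m (conjT m ξ)) v := by
    induction ξ using TensorProduct.induction_on with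
    | zero => simp
    | tmul z w => simp [hr, mul_comm]
    | add x y hx hy => simp only [map_add, hx, hy, inner_add_left]
  have hd : MDifferentiableAt 𝓘(ℝ, E) 𝓘(ℝ, ℂ) (fun p => IMap 𝒦 v p (g.sec p)) m := by
    refine MDifferentiableAt.congr_of_eventuallyEq ?_ hev
    exact hb.differentiableAt.mdifferentiableAt.comp m (hK.prodMk_space hv)
  rw [CoherentMap.connLBarDual_eq g _ h hd, g.connLBarDual_eq _ h, cderiv_congr hev, hC, hsec m h,
    g.perp_apply, inner_sub_left, inner_smul_left]

theorem Gauge.connLBarDual_IMap_eq_zero_iff {𝒦 : M → ℙ ℂ 𝔐} (g : Gauge E 𝒦) {m : M}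
    (h : m ∈ g.Ω) (ξ : CTangent E m) :
    (∀ ψ ∈ LinearMap.range (IMap 𝒦), CoherentMap.connLBarDual 𝒦 ψ m ξ = 0) ↔
      g.perp m (conjT m ξ) = 0 := by
  constructor
  · intro H
    -- Testing on this vector itself turns the coefficient into its squared norm.
    have h1 := H _ ⟨g.perp m (conjT m ξ), rfl⟩
    rw [g.connLBarDual_IMap h] at h1
    have h2 := congrArg (fun l : LBarDual 𝒦 m => l (g.sec m)) h1
    simpa [g.secBarDual_sec h] using h2
  · rintro H _ ⟨v, rfl⟩
    rw [g.connLBarDual_IMap h, H, inner_zero_left, zero_smul]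

/-- The exterior derivative of the connection form of a gauge. -/
theorem Gauge.extDer_ΘReal [IsManifold 𝓘(ℝ, E) ∞ M] {𝒦 : M → ℙ ℂ 𝔐} (g : Gauge E 𝒦) {m : M}
    (h : m ∈ g.Ω) (a b : TangentSpace 𝓘(ℝ, E) m) :
    extDer g.ΘReal m a b =
      (inner ℂ (g.K m) (g.K m))⁻¹ *
        (inner ℂ (g.perp m (1 ⊗ₜ a)) (g.perp m (1 ⊗ₜ b)) -
          inner ℂ (g.perp m (1 ⊗ₜ b)) (g.perp m (1 ⊗ₜ a))) := by
  have hKm := g.smooth.contMDiffAt (g.isOpen.mem_nhds h)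
  have hK := hKm.mdifferentiableAt (by simp : (∞ : WithTop ℕ∞) ≠ 0)
  have hN : inner ℂ (g.K m) (g.K m) ≠ (0 : ℂ) := inner_self_ne_zero.mpr (g.ne_zero m h)
  rw [g.inner_perp_perp h, g.inner_perp_perp h]
  simp only [cderiv_tmul, one_smul]
  rw [rderiv_eq_fderiv_chart hK, rderiv_eq_fderiv_chart hK]
  simp only [extDer, LinearMap.mk₂_apply]
  set φ := extChartAt 𝓘(ℝ, E) m with hφ
  set κ : E → 𝔐 := g.K ∘ φ.symm with hκ
  have hinv : φ.symm (φ m) = m := extChartAt_to_inv m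
  have hκm : g.K m = κ (φ m) := by rw [hκ, Function.comp_apply, hinv]
  have hκd : ContDiffAt ℝ ∞ κ (φ m) :=
    contMDiffAt_iff_contDiffAt.1 (ContMDiffAt.comp (φ m) (by rwa [hinv])
      ((contMDiffOn_extChartAt_symm (I := 𝓘(ℝ, E)) (n := ∞) m).contMDiffAt
        (extChartAt_target_mem_nhds (I := 𝓘(ℝ, E)) m)))
  have hκ1 : HasFDerivAt κ (fderiv ℝ κ (φ m)) (φ m) :=
    (hκd.differentiableAt (by simp)).hasFDerivAt
  have hκ2 : DifferentiableAt ℝ (fderiv ℝ κ) (φ m) :=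
    (hκd.fderiv_right (m := 1) (by exact WithTop.coe_le_coe.2 le_top)).differentiableAt (by simp)
  rw [hκm] at hN ⊢
  have e1 : chartForm g.ΘReal m =ᶠ[𝓝 (φ m)] fun y =>
      (inner ℂ (κ y) (κ y) : ℂ)⁻¹ • ((innerSL ℂ (κ y)).restrictScalars ℝ).comp (fderiv ℝ κ y) := by
    filter_upwards [chartForm_eventuallyEq hKm] with y hy
    rw [← hy]
    rfl
  have dθ : DifferentiableAt ℝ (chartForm g.ΘReal m) (φ m) := by
    rw [e1.differentiableAt_iff]
    refine DifferentiableAt.smul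
      ((hκ1.differentiableAt.inner ℂ hκ1.differentiableAt).inv hN) ?_
    refine DifferentiableAt.clm_comp ?_ hκ2
    exact (isBoundedBilinearMap_inner (𝕜 := ℂ) (E := 𝔐)).toContinuousLinearMap.differentiableAt.comp
      (φ m) hκ1.differentiableAt
  -- Leibniz rule for ⟨κ|κ⟩⁻¹⟨κ|∂_w κ⟩ in direction u; the last summand comes from differentiating
  -- ⟨κ|κ⟩⁻¹.
  have key : ∀ u w : E, fderiv ℝ (chartForm g.ΘReal m) (φ m) u w =
      (inner ℂ (κ (φ m)) (κ (φ m)))⁻¹ *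
        (inner ℂ (κ (φ m)) (fderiv ℝ (fderiv ℝ κ) (φ m) u w) +
          inner ℂ (fderiv ℝ κ (φ m) u) (fderiv ℝ κ (φ m) w)) -
      ((inner ℂ (κ (φ m)) (κ (φ m)) : ℂ) ^ 2)⁻¹ *
        (inner ℂ (κ (φ m)) (fderiv ℝ κ (φ m) u) + inner ℂ (fderiv ℝ κ (φ m) u) (κ (φ m))) *
        inner ℂ (κ (φ m)) (fderiv ℝ κ (φ m) w) := by
    intro u w
    have h1 : fderiv ℝ (chartForm g.ΘReal m) (φ m) u w =
        fderiv ℝ (fun y => chartForm g.ΘReal m y w) (φ m) u := by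
      rw [fderiv_clm_apply dθ (differentiableAt_const w)]
      simp
    have e2 : (fun y => chartForm g.ΘReal m y w) =ᶠ[𝓝 (φ m)] fun y =>
        (inner ℂ (κ y) (κ y) : ℂ)⁻¹ * inner ℂ (κ y) (fderiv ℝ κ y w) := by
      filter_upwards [e1] with y hy
      rw [hy]
      rfl
    have hw : HasFDerivAt (fun y => fderiv ℝ κ y w) _ (φ m) :=
      hκ2.hasFDerivAt.clm_apply (hasFDerivAt_const w (φ m))
    have hi := (hasFDerivAt_inv' (𝕜 := ℝ) hN).comp (φ m) (hκ1.inner ℂ hκ1)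
    have hp := hi.mul (hκ1.inner ℂ hw)
    rw [h1, e2.fderiv_eq]
    refine (congrArg (fun T : E →L[ℝ] ℂ => T u) hp.fderiv).trans ?_
    simp
    field_simp
    ring
  have hsymm : IsSymmSndFDerivAt ℝ κ (φ m) :=
    hκd.isSymmSndFDerivAt (by simp; exact WithTop.coe_le_coe.2 le_top)
  -- Antisymmetrizing kills the second derivative of κ and the product ⟨κ|∂_u κ⟩⟨κ|∂_w κ⟩, both
  -- symmetric in u and w. What is left is the expanded form of the orthogonal inner products.
  have hanti : ∀ u w : E, fderiv ℝ (chartForm g.ΘReal m) (φ m) u w -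
      fderiv ℝ (chartForm g.ΘReal m) (φ m) w u =
      (inner ℂ (κ (φ m)) (κ (φ m)))⁻¹ *
        (inner ℂ (fderiv ℝ κ (φ m) u) (fderiv ℝ κ (φ m) w) -
          inner ℂ (fderiv ℝ κ (φ m) u) (κ (φ m)) * inner ℂ (κ (φ m)) (fderiv ℝ κ (φ m) w) /
            inner ℂ (κ (φ m)) (κ (φ m)) -
          (inner ℂ (fderiv ℝ κ (φ m) w) (fderiv ℝ κ (φ m) u) -
            inner ℂ (fderiv ℝ κ (φ m) w) (κ (φ m)) * inner ℂ (κ (φ m)) (fderiv ℝ κ (φ m) u) /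
              inner ℂ (κ (φ m)) (κ (φ m)))) := by
    intro u w
    rw [key, key, hsymm.eq]
    field_simp
    ring
  exact hanti _ _

/-- Conjugating the vector in the first slot compensates the conjugate linearity of the inner
product there, so both sides are complex bilinear and agree because they do on real vectors. -/
theorem Gauge.curvForm_apply [IsManifold 𝓘(ℝ, E) ∞ M] {𝒦 : M → ℙ ℂ 𝔐} (g : Gauge E 𝒦) {m : M}
    (h : m ∈ g.Ω) (ξ η : CTangent E m) :
    g.curvForm m ξ η = Complex.I * ((inner ℂ (g.K m) (g.K m))⁻¹ *
        (inner ℂ (g.perp m (conjT m ξ)) (g.perp m η) -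
          inner ℂ (g.perp m (conjT m η)) (g.perp m ξ))) := by
  have hsmul : ∀ (z : ℂ) (v : TangentSpace 𝓘(ℝ, E) m),
      g.perp m (z ⊗ₜ v) = z • g.perp m (1 ⊗ₜ v) := fun z v => by
    rw [← map_smul, TensorProduct.smul_tmul', smul_eq_mul, mul_one]
  simp only [Gauge.curvForm, LinearMap.smul_apply, smul_eq_mul]
  congr 1
  induction ξ using TensorProduct.induction_on with
  | zero => simp
  | tmul z v =>
    induction η using TensorProduct.induction_on with
    | zero => simp
    | tmul w u =>
      rw [complexify_tmul, g.extDer_ΘReal h, conjT_tmul, conjT_tmul, hsmul (conj z), hsmul (conj w),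
        hsmul z, hsmul w]
      simp only [inner_smul_left, inner_smul_right, Complex.conj_conj]
      ring
    | add x y hx hy => simp only [map_add, hx, hy, inner_add_left, inner_add_right]; ring
  | add x y hx hy =>
    simp only [map_add, LinearMap.add_apply, hx, hy, inner_add_left, inner_add_right]; ring

section

variable [IsManifold 𝓘(ℝ, E) ∞ M]

theorem Gauge.perp_eq_zero_of_mem_P {𝒦 : M → ℙ ℂ 𝔐} (g : Gauge E 𝒦) {m : M} (h : m ∈ g.Ω)
    {ξ : CTangent E m} (hξ : ξ ∈ P 𝒦 m) : g.perp m (conjT m ξ) = 0 := by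
  obtain ⟨X, hX, rfl⟩ := hξ
  exact (g.connLBarDual_IMap_eq_zero_iff h _).1 fun ψ hψ => hX.2 ψ hψ m

/-- Membership in P_m asks for a globally annihilating smooth field through the given vector; here X
itself serves as that field at every point. -/
theorem mem_smoothSections_P {𝒦 : M → ℙ ℂ 𝔐} {X : Π m : M, CTangent E m} (hX : IsSmoothField X)
    (H : ∀ m, ∃ g : Gauge E 𝒦, m ∈ g.Ω ∧ g.perp m (conjT m (X m)) = 0) :
    X ∈ smoothSections (P 𝒦) := by
  refine ⟨hX, fun m => ⟨X, ⟨hX, fun ψ hψ p => ?_⟩, rfl⟩⟩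
  obtain ⟨g, hg, h0⟩ := H p
  exact (g.connLBarDual_IMap_eq_zero_iff hg _).2 h0 ψ hψ

end

end CoherentMap

/-! ### Complex vector fields: conjugation, brackets and involutivity. -/

namespace CoherentMap

section Bracket

variable {E : Type*} [NormedAddCommGroup E] [NormedSpace ℝ E]
  {M : Type*} [TopologicalSpace M] [ChartedSpace E M]
  {F : Type*} [NormedAddCommGroup F] [NormedSpace ℂ F]

theorem rderiv_add_I_smul {u w : M → F} {m : M} (hu : MDifferentiableAt 𝓘(ℝ, E) 𝓘(ℝ, F) u m)
    (hw : MDifferentiableAt 𝓘(ℝ, E) 𝓘(ℝ, F) w m) (v : TangentSpace 𝓘(ℝ, E) m) :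
    rderiv (fun p => u p + Complex.I • w p) m v =
      rderiv (E := E) u m v + Complex.I • rderiv (E := E) w m v :=
  rderiv_pair hu hw (G := fun x : F × F => x.1 + Complex.I • x.2)
    (hasFDerivAt_fst.add (hasFDerivAt_snd.const_smul Complex.I)) v

theorem cderiv_smul {c : M → ℂ} {f : M → F} {m : M}
    (hc : MDifferentiableAt 𝓘(ℝ, E) 𝓘(ℝ, ℂ) c m) (hf : MDifferentiableAt 𝓘(ℝ, E) 𝓘(ℝ, F) f m)
    (ξ : CTangent E m) :
    cderiv (fun p => c p • f p) m ξ =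
      c m • cderiv (E := E) f m ξ + cderiv (E := E) c m ξ • f m := by
  have hb : HasFDerivAt (𝕜 := ℝ) (fun x : ℂ × F => x.1 • x.2) _ (c m, f m) :=
    hasFDerivAt_fst.smul hasFDerivAt_snd
  have hr : ∀ v : TangentSpace 𝓘(ℝ, E) m, rderiv (fun p => c p • f p) m v =
      c m • rderiv (E := E) f m v + rderiv (E := E) c m v • f m := fun v => rderiv_pair hc hf hb v
  induction ξ using TensorProduct.induction_on with
  | zero => simp
  | tmul z v => simp only [cderiv_tmul, hr, smul_add, smul_smul, smul_eq_mul, mul_comm z]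
  | add x y hx hy => simp only [map_add, hx, hy, smul_add, add_smul]; abel

theorem rePart_mkC {m : M} (a b : TangentSpace 𝓘(ℝ, E) m) : rePart m (mkC a b) = a := by
  simp [mkC]

theorem imPart_mkC {m : M} (a b : TangentSpace 𝓘(ℝ, E) m) : imPart m (mkC a b) = b := by
  simp [mkC]

theorem rePart_conjT {m : M} (ξ : CTangent E m) : rePart m (conjT m ξ) = rePart m ξ := by
  rw [← mkC_rePart_imPart ξ, conjT_mkC, rePart_mkC, rePart_mkC]

theorem imPart_conjT {m : M} (ξ : CTangent E m) : imPart m (conjT m ξ) = -imPart m ξ := by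
  rw [← mkC_rePart_imPart ξ, conjT_mkC, imPart_mkC, imPart_mkC]

variable [IsManifold 𝓘(ℝ, E) ∞ M]

theorem IsSmoothField.conj {X : Π m : M, CTangent E m} (hX : IsSmoothField X) :
    IsSmoothField (fun m => conjT m (X m)) := by
  refine ⟨?_, ?_⟩
  · simpa only [rePart_conjT] using! hX.1
  · simpa only [imPart_conjT] using! hX.2.neg_section

theorem isSmoothField_cbracket [CompleteSpace E] {X Y : Π m : M, CTangent E m}
    (hX : IsSmoothField X) (hY : IsSmoothField Y) : IsSmoothField (cbracket X Y) := by
  have : IsManifold 𝓘(ℝ, E) (minSmoothness ℝ 2) M :=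
    .of_le (n := ∞) (by simp; exact WithTop.coe_le_coe.2 le_top)
  have : IsManifold 𝓘(ℝ, E) (((⊤ : ℕ∞) : WithTop ℕ∞) + 1) M := .of_le (n := ∞) le_rfl
  have br : ∀ {V W : Π m : M, TangentSpace 𝓘(ℝ, E) m},
      ContMDiff 𝓘(ℝ, E) 𝓘(ℝ, E).tangent ∞
        (fun m => (⟨m, V m⟩ : TangentBundle 𝓘(ℝ, E) M)) →
      ContMDiff 𝓘(ℝ, E) 𝓘(ℝ, E).tangent ∞
        (fun m => (⟨m, W m⟩ : TangentBundle 𝓘(ℝ, E) M)) →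
      ContMDiff 𝓘(ℝ, E) 𝓘(ℝ, E).tangent ∞
        (fun m => (⟨m, VectorField.mlieBracket 𝓘(ℝ, E) V W m⟩ : TangentBundle 𝓘(ℝ, E) M)) :=
    fun hV hW p => ContMDiffAt.mlieBracket_vectorField (m := ⊤) (n := ⊤) (hV p) (hW p) (by simp)
  refine ⟨?_, ?_⟩
  · simpa only [cbracket, rePart_mkC] using!
      (br hX.1 hY.1).sub_section (br hX.2 hY.2)
  · simpa only [cbracket, imPart_mkC] using!
      (br hX.1 hY.2).add_section (br hX.2 hY.1)

theorem mdifferentiableAt_cderiv_apply [CompleteSpace E] {f : M → F} {m : M}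
    (hf : ContMDiffAt 𝓘(ℝ, E) 𝓘(ℝ, F) ∞ f m) {X : Π m : M, CTangent E m} (hX : IsSmoothField X) :
    MDifferentiableAt 𝓘(ℝ, E) 𝓘(ℝ, F) (fun p => cderiv f p (X p)) m := by
  have h : (fun p => cderiv f p (X p)) = fun p =>
      rderiv (E := E) f p (rePart p (X p)) + Complex.I • rderiv (E := E) f p (imPart p (X p)) := by
    funext p
    rw [← cderiv_mkC, mkC_rePart_imPart]
  rw [h]
  have h1 := mdifferentiableAt_rderiv_apply hf ((hX.1 m).mdifferentiableAt (by simp))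
  have h2 := mdifferentiableAt_rderiv_apply hf ((hX.2 m).mdifferentiableAt (by simp))
  have hG : DifferentiableAt ℝ (fun x : F × F => x.1 + Complex.I • x.2)
      (rderiv (E := E) f m (rePart m (X m)), rderiv (E := E) f m (imPart m (X m))) :=
    differentiableAt_fst.add (differentiableAt_snd.const_smul Complex.I)
  exact hG.mdifferentiableAt.comp m (h1.prodMk_space h2)

/-- The derivation along the bracket of complex vector fields is the commutator of the
derivations. -/
theorem cderiv_cbracket [CompleteSpace E] {f : M → F} {m : M}
    (hf : ContMDiffAt 𝓘(ℝ, E) 𝓘(ℝ, F) ∞ f m) {X Y : Π m : M, CTangent E m}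
    (hX : IsSmoothField X) (hY : IsSmoothField Y) :
    cderiv f m (cbracket X Y m) =
      cderiv (fun p => cderiv (E := E) f p (Y p)) m (X m) -
        cderiv (fun p => cderiv (E := E) f p (X p)) m (Y m) := by
  have hd : ∀ {V : Π m : M, TangentSpace 𝓘(ℝ, E) m},
      ContMDiff 𝓘(ℝ, E) 𝓘(ℝ, E).tangent ∞ (fun m => (⟨m, V m⟩ : TangentBundle 𝓘(ℝ, E) M)) →
      MDifferentiableAt 𝓘(ℝ, E) 𝓘(ℝ, E).tangent
        (fun m => (⟨m, V m⟩ : TangentBundle 𝓘(ℝ, E) M)) m :=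
    fun hV => (hV m).mdifferentiableAt (by simp)
  have hexp : ∀ {Z : Π m : M, CTangent E m}, IsSmoothField Z → ∀ v : TangentSpace 𝓘(ℝ, E) m,
      rderiv (fun p => cderiv (E := E) f p (Z p)) m v =
        rderiv (fun p => rderiv (E := E) f p (rePart p (Z p))) m v +
          Complex.I • rderiv (fun p => rderiv (E := E) f p (imPart p (Z p))) m v := by
    intro Z hZ v
    have h : (fun p => cderiv f p (Z p)) = fun p =>
        rderiv (E := E) f p (rePart p (Z p)) +
          Complex.I • rderiv (E := E) f p (imPart p (Z p)) := by
      funext p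
      rw [← cderiv_mkC, mkC_rePart_imPart]
    rw [h, rderiv_add_I_smul (mdifferentiableAt_rderiv_apply hf (hd hZ.1))
      (mdifferentiableAt_rderiv_apply hf (hd hZ.2))]
  -- Both sides become combinations of the four real commutators; the minus sign in the real part of
  -- the bracket matches i² = -1.
  rw [← mkC_rePart_imPart (X m), ← mkC_rePart_imPart (Y m), cderiv_mkC, cderiv_mkC,
    hexp hX, hexp hX, hexp hY, hexp hY, cbracket, cderiv_mkC, map_sub, map_add,
    rderiv_mlieBracket hf (hd hX.1) (hd hY.1), rderiv_mlieBracket hf (hd hX.2) (hd hY.2),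
    rderiv_mlieBracket hf (hd hX.1) (hd hY.2), rderiv_mlieBracket hf (hd hX.2) (hd hY.1)]
  simp only [smul_add, smul_sub, smul_smul, Complex.I_mul_I, neg_smul, one_smul]
  abel

/-- The bracket extends a real operation: changing the sign of both imaginary parts leaves the
imaginary-imaginary term alone and flips the two mixed terms. -/
theorem conjT_cbracket [CompleteSpace E] {X Y : Π m : M, CTangent E m}
    (hX : IsSmoothField X) (hY : IsSmoothField Y) (m : M) :
    conjT m (cbracket X Y m) =
      cbracket (fun p => conjT p (X p)) (fun p => conjT p (Y p)) m := by
  have : IsManifold 𝓘(ℝ, E) 2 M := .of_le (n := ∞) (by exact WithTop.coe_le_coe.2 le_top)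
  have hneg : ∀ Z : Π m : M, CTangent E m,
      (fun p => -imPart p (Z p)) = (-1 : ℝ) • fun p => imPart p (Z p) := fun Z => by
    funext p
    simp
  have hl : ∀ W : Π p : M, TangentSpace 𝓘(ℝ, E) p,
      VectorField.mlieBracket 𝓘(ℝ, E) (fun p => -imPart p (X p)) W m =
        -VectorField.mlieBracket 𝓘(ℝ, E) (fun p => imPart p (X p)) W m := fun W => by
    rw [hneg, VectorField.mlieBracket_const_smul_left ((hX.2 m).mdifferentiableAt (by simp)),
      neg_one_smul]
  have hr : ∀ V : Π p : M, TangentSpace 𝓘(ℝ, E) p,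
      VectorField.mlieBracket 𝓘(ℝ, E) V (fun p => -imPart p (Y p)) m =
        -VectorField.mlieBracket 𝓘(ℝ, E) V (fun p => imPart p (Y p)) m := fun V => by
    rw [hneg, VectorField.mlieBracket_const_smul_right ((hY.2 m).mdifferentiableAt (by simp)),
      neg_one_smul]
  simp only [cbracket, conjT_mkC, rePart_conjT, imPart_conjT, hl, hr]
  rw [neg_neg, neg_add]

end Bracket

variable {𝔐 : Type*} [NormedAddCommGroup 𝔐] [InnerProductSpace ℂ 𝔐]
  {E : Type*} [NormedAddCommGroup E] [NormedSpace ℝ E] [CompleteSpace E]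
  {M : Type*} [TopologicalSpace M] [ChartedSpace E M] [IsManifold 𝓘(ℝ, E) ∞ M]

/-- If two vector fields preserve the line of `K`, then so does their bracket. -/
theorem Gauge.perp_cbracket {𝒦 : M → ℙ ℂ 𝔐} (g : Gauge E 𝒦) {m : M} (h : m ∈ g.Ω)
    {X Y : Π m : M, CTangent E m} (hX : IsSmoothField X) (hY : IsSmoothField Y)
    (hX0 : ∀ p ∈ g.Ω, g.perp p (X p) = 0) (hY0 : ∀ p ∈ g.Ω, g.perp p (Y p) = 0) :
    g.perp m (cbracket X Y m) = 0 := by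
  have hKm := g.smooth.contMDiffAt (g.isOpen.mem_nhds h)
  have hK := hKm.mdifferentiableAt (by simp : (∞ : WithTop ℕ∞) ≠ 0)
  have hN : inner ℂ (g.K m) (g.K m) ≠ (0 : ℂ) := inner_self_ne_zero.mpr (g.ne_zero m h)
  -- The identity Z(K) = Θ(Z)K holds on the open set Ω, not only at m, so it may be differentiated
  -- by the product rule.
  have key : ∀ {Z : Π m : M, CTangent E m}, IsSmoothField Z → (∀ p ∈ g.Ω, g.perp p (Z p) = 0) →
      ∀ ξ : CTangent E m, cderiv (fun p => cderiv g.K p (Z p)) m ξ =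
        g.Θ m (Z m) • cderiv g.K m ξ + cderiv (fun p => g.Θ p (Z p)) m ξ • g.K m := by
    intro Z hZ hZ0 ξ
    have hθ : MDifferentiableAt 𝓘(ℝ, E) 𝓘(ℝ, ℂ) (fun p => g.Θ p (Z p)) m := by
      simp only [g.Θ_apply]
      have hG : DifferentiableAt ℝ
          (fun x : 𝔐 × 𝔐 => (inner ℂ x.1 x.2 / inner ℂ x.1 x.1 : ℂ))
          (g.K m, cderiv g.K m (Z m)) := by
        simp only [div_eq_mul_inv]
        exact (differentiableAt_fst.inner ℂ differentiableAt_snd).mul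
          ((differentiableAt_fst.inner ℂ differentiableAt_fst).inv hN)
      exact hG.mdifferentiableAt.comp m (hK.prodMk_space (mdifferentiableAt_cderiv_apply hKm hZ))
    have hev : (fun p => cderiv g.K p (Z p)) =ᶠ[𝓝 m] fun p => g.Θ p (Z p) • g.K p := by
      filter_upwards [g.isOpen.mem_nhds h] with p hp using sub_eq_zero.1 (hZ0 p hp)
    rw [cderiv_congr hev, cderiv_smul hθ hK]
  -- In the commutator the terms Θ(X)Θ(Y)K cancel, leaving the factor X(Θ(Y)) - Y(Θ(X)).
  apply g.perp_eq_zero_of_cderiv_eq h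
    (c := cderiv (fun p => g.Θ p (Y p)) m (X m) - cderiv (fun p => g.Θ p (X p)) m (Y m))
  rw [cderiv_cbracket hKm hX hY, key hX hX0, key hY hY0, sub_eq_zero.1 (hX0 m h),
    sub_eq_zero.1 (hY0 m h)]
  simp only [LinearMap.smulRight_apply]
  rw [smul_comm (g.Θ m (Y m)), sub_smul]
  abel

end CoherentMap

/-! ### The four assertions. -/

theorem proposition2p1
    {𝔐 : Type*} [NormedAddCommGroup 𝔐] [InnerProductSpace ℂ 𝔐] [CompleteSpace 𝔐]
    {E : Type*} [NormedAddCommGroup E] [NormedSpace ℝ E] [FiniteDimensional ℝ E]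
    {M : Type*} [TopologicalSpace M] [ChartedSpace E M] [IsManifold 𝓘(ℝ, E) ∞ M]
    (𝒦 : M → ℙ ℂ 𝔐) {J : Type*} (g : J → Gauge E 𝒦) (hcover : ∀ m, ∃ α, m ∈ (g α).Ω) :
    (∀ X : Π m : M, CTangent E m, IsSmoothField X →
      (X ∈ smoothSections (P 𝒦) ↔
        ∀ α, ∀ m ∈ (g α).Ω,
          cderiv (g α).K m (conjT m (X m)) = (g α).Θ m (conjT m (X m)) • (g α).K m)) ∧
    (∀ X ∈ smoothSections (P (E := E) 𝒦), ∀ Y ∈ smoothSections (P (E := E) 𝒦),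
      cbracket X Y ∈ smoothSections (P 𝒦) ∧ ∀ m, curvForm E 𝒦 m (X m) (Y m) = 0) ∧
    (∀ X ∈ smoothSections (fun m => P (E := E) 𝒦 m ⊓ PBar 𝒦 m),
      ∀ m, ∀ η : CTangent E m, curvForm E 𝒦 m (X m) η = 0) ∧
    (∀ X ∈ smoothSections (P (E := E) 𝒦),
      ∀ m, 0 ≤ Complex.I * curvForm E 𝒦 m (X m) (conjT m (X m))) := by
  have : CompleteSpace E := FiniteDimensional.complete ℝ E
  refine ⟨fun X hX => ⟨fun h α m hm => ?_, fun h => ?_⟩, fun X hX Y hY => ⟨?_, fun m => ?_⟩,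
    fun X hX m η => ?_, fun X hX m => ?_⟩
  · exact sub_eq_zero.1 ((g α).perp_eq_zero_of_mem_P hm (h.2 m))
  · refine mem_smoothSections_P hX fun m => ?_
    obtain ⟨α, hα⟩ := hcover m
    exact ⟨g α, hα, sub_eq_zero.2 (h α m hα)⟩
  · refine mem_smoothSections_P (isSmoothField_cbracket hX.1 hY.1) fun m => ?_
    obtain ⟨α, hα⟩ := hcover m
    refine ⟨g α, hα, ?_⟩
    rw [conjT_cbracket hX.1 hY.1]
    exact (g α).perp_cbracket hα hX.1.conj hY.1.conj
      (fun p hp => (g α).perp_eq_zero_of_mem_P hp (hX.2 p))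
      (fun p hp => (g α).perp_eq_zero_of_mem_P hp (hY.2 p))
  · obtain ⟨α, hα⟩ := hcover m
    rw [curvForm_eq (g α) hα, (g α).curvForm_apply hα,
      (g α).perp_eq_zero_of_mem_P hα (hX.2 m), (g α).perp_eq_zero_of_mem_P hα (hY.2 m)]
    simp
  · obtain ⟨α, hα⟩ := hcover m
    -- Here X(m) is the conjugate of some ζ in P, so the orthogonal component of X(m) vanishes as
    -- well as that of its conjugate.
    obtain ⟨hP, ζ, hζ, hζX⟩ := hX.2 m
    have h2 := (g α).perp_eq_zero_of_mem_P hα hζ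
    rw [hζX] at h2
    rw [curvForm_eq (g α) hα, (g α).curvForm_apply hα, (g α).perp_eq_zero_of_mem_P hα hP, h2]
    simp
  · obtain ⟨α, hα⟩ := hcover m
    rw [curvForm_eq (g α) hα, (g α).curvForm_apply hα, conjT_conjT,
      (g α).perp_eq_zero_of_mem_P hα (hX.2 m), inner_zero_left, zero_sub, mul_neg, mul_neg,
      mul_neg, ← mul_assoc, Complex.I_mul_I, neg_one_mul, neg_neg, inner_self_eq_norm_sq_to_K,
      inner_self_eq_norm_sq_to_K]
    -- What remains is ‖K‖⁻²‖π(X)‖². The order on ℂ is the one in which `0 ≤ z` includes that z is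
    -- real, so reality is proved along with the sign.
    refine mul_nonneg (inv_nonneg.2 ?_) ?_
    · change (0 : ℂ) ≤ ((‖(g α).K m‖ : ℝ) : ℂ) ^ 2
      exact_mod_cast sq_nonneg ‖(g α).K m‖
    · change (0 : ℂ) ≤ ((‖(g α).perp m (X m)‖ : ℝ) : ℂ) ^ 2
      exact_mod_cast sq_nonneg ‖(g α).perp m (X m)‖
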